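/- All strings are over a fixed finite alphabet $\Sigma$. A decision problem is a binary relation $\mathcal P\subseteq\Sigma^*\times\Sigma^*$ between a data part $D$ and a problem part $P$. A function $f:\Sigma^*\to\Sigma^*$ is linear-size NC computable if it is computed in polylogarithmic time by a parallel random-access machine with polynomially many processors, and $|f(x)|=O(|x|)$. A function $g:\Sigma^*\times\Sigma^*\to\Sigma^*$ is PsT computable if there are a polynomial-time computable function $\Pi:\Sigma^*\to\Sigma^*$, a random-access Turing machine $M$ and a function $t(n)=o(n)$ such that, for all $x,y\in\Sigma^*$, $M$ on input $\Pi(x)\#y$ outputs $g(x,y)$ within $t(|x|)$ steps. We write $\mathcal P_1\le^{\mathrm{PsT}}_m\mathcal P_2$ if there are linear-size NC computable functions $f_1,f_2$ and a PsT computable function $g$ such that, for all strings $D,P$, $$\langle D,P\rangle\in\mathcal P_1\iff\langle f_1(D),\,g(f_2(D),P)\rangle\in\mathcal P_2 .$$ Circuit value problem (CVP). The data part is a Boolean circuit $\alpha$ with inputs $x_1,\dots,x_d$ and gates AND, OR (of fan-in two) and NOT, given as the list of its nodes (inputs first, then the gates, each gate taking its arguments from earlier nodes), where each node, inputs included, is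 listed with its number in binary, its kind and the numbers of its arguments; the last node is the output. The problem part is a list of $d$ truth values for $x_1,\dots,x_d$. The question is whether the output of $\alpha$ on these inputs is TRUE. Algebraic equation root problem (AERP). The data part is a polynomial equation $L=R$ with integer coefficients in variables $x_1,\dots,x_d$, given by a straight-line program: a list of the variables, then a list of definitions of further quantities, each by an expression built with $+,-,\times$ from integer constants and earlier quantities, and finally two such expressions $L$ and $R$. The problem part is a list of $d$ integers $a_1,\dots,a_d$ in binary. Blanks in the strings are ignored. The question is whether $(a_1,\dots,a_d)$ is a root of the equation, that is, whether $L=R$ holds at $x_1=a_1,\dots,x_d=a_d$. **Theorem.** $\mathrm{CVP}\le^{\mathrm{PsT}}_m\mathrm{AERP}$. -/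

import Mathlib

open Filter Asymptotics

/-! ## Strings and problems -/

/-- The finite alphabet in which data parts and problem parts are written. -/
inductive Letter : Type
  /-- binary digits -/
  | b0 | b1
  /-- input declaration; `AND`, `OR`, `NOT` gates -/
  | inp | conj | disj | neg
  /-- argument separator, end of record -/
  | comma | fin
  /-- definition of a node, node reference, operators, equality -/
  | asg | ref | plus | minus | times | eql
  /-- nonnegative and negative integer literals -/
  | pos | ngt
  /-- a blank -/
  | blank
  deriving DecidableEq

instance : Fintype Letter where
  elems := {.b0, .b1, .inp, .conj, .disj, .neg, .comma, .fin, .asg, .ref, .plus, .minus, .times,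
    .eql, .pos, .ngt, .blank}
  complete x := by cases x <;> decide

/-- The number representing a symbol in the memory of a parallel machine; `0` is kept for
"no symbol". -/
def Letter.code : Letter → ℕ
  | b0 => 1 | b1 => 2 | inp => 3 | conj => 4 | disj => 5 | neg => 6 | comma => 7 | fin => 8
  | asg => 9 | ref => 10 | plus => 11 | minus => 12 | times => 13 | eql => 14 | pos => 15
  | ngt => 16 | blank => 17

/-- A decision problem whose input is split into a data part and a problem part: `𝒫 D P` means
`⟨D, P⟩ ∈ 𝒫`. -/
def Problem : Type := List Letter → List Letter → Prop

/-! ## Random-access Turing machines -/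

/-- Head moves on one-way infinite tapes. -/
inductive Move : Type
  | left | stay | right

/-- New head position; a left move on cell `0` stays there. -/
def Move.apply : Move → ℕ → ℕ
  | left, p => p - 1
  | stay, p => p
  | right, p => p + 1

/-- What a random-access Turing machine does in one step. There are `k + 1` work tapes, and an
index tape for each work tape (`some i`) and for the input tape (`none`). -/
structure RAction (k : ℕ) (State Work : Type) where
  next : State
  inMove : Move
  write : Fin (k + 1) → Option Work
  move : Fin (k + 1) → Move
  ixWrite : Option (Fin (k + 1)) → Option Bool
  ixMove : Option (Fin (k + 1)) → Move

/-- A random-access Turing machine with a read-only input tape over `I`, with `k + 1` work tapes,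
the work tape `0` being also the output tape, and with one binary index tape for each of these.
`none` is the blank on every tape. The transition function sees the scanned symbols of all
tapes, and returns `none` to halt. -/
structure RATM (I O : Type) where
  k : ℕ
  State : Type
  [stateFin : Fintype State]
  [stateDec : DecidableEq State]
  Work : Type
  [workFin : Fintype Work]
  start : State
  /-- the random access state -/
  access : State
  /-- output symbols are work symbols -/
  outSym : O ↪ Work
  δ : State → Option I → (Fin (k + 1) → Option Work) → (Option (Fin (k + 1)) → Option Bool) →
    Option (RAction k State Work)

namespace RATM

variable {I O : Type}

/-- Configurations: state, contents of the writable tapes, head positions. -/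
structure Config (M : RATM I O) where
  state : M.State
  inHead : ℕ
  tape : Fin (M.k + 1) → ℕ → Option M.Work
  head : Fin (M.k + 1) → ℕ
  ixTape : Option (Fin (M.k + 1)) → ℕ → Option Bool
  ixHead : Option (Fin (M.k + 1)) → ℕ

/-- The number written on an index tape: cell `i` holds the binary digit of weight `2 ^ i`, and
blank cells count as `0`. (Only finitely many cells are ever nonblank.) -/
noncomputable def ixValue (T : ℕ → Option Bool) : ℕ :=
  ∑ᶠ i : ℕ, if T i = some true then 2 ^ i else 0

/-- The start: all writable tapes blank, all heads on cell `0`. -/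
def init (M : RATM I O) : M.Config where
  state := M.start
  inHead := 0
  tape _ _ := none
  head _ := 0
  ixTape _ _ := none
  ixHead _ := 0

/-- The action chosen in a configuration, if the machine has not halted. -/
def action (M : RATM I O) (input : List I) (c : M.Config) :
    Option (RAction M.k M.State M.Work) :=
  M.δ c.state input[c.inHead]? (fun i => c.tape i (c.head i)) (fun j => c.ixTape j (c.ixHead j))

/-- Perform an action, without random access. -/
def perform (M : RATM I O) (c : M.Config) (a : RAction M.k M.State M.Work) : M.Config where
  state := a.next
  inHead := a.inMove.apply c.inHead
  tape i := Function.update (c.tape i) (c.head i) (a.write i)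
  head i := (a.move i).apply (c.head i)
  ixTape j := Function.update (c.ixTape j) (c.ixHead j) (a.ixWrite j)
  ixHead j := (a.ixMove j).apply (c.ixHead j)

/-- Move the head of every non-index tape to the cell described by its index tape. -/
noncomputable def jump (M : RATM I O) (c : M.Config) : M.Config :=
  { c with
    inHead := ixValue (c.ixTape none)
    head := fun i => ixValue (c.ixTape (some i)) }

/-- One step. Entering the random access state includes the jump of the heads. A machine that has
halted stays as it is. -/
noncomputable def step (M : RATM I O) (input : List I) (c : M.Config) : M.Config :=
  match M.action input c with
  | none => c
  | some a =>
    haveI := M.stateDec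
    if a.next = M.access then M.jump (M.perform c a) else M.perform c a

/-- `M` halts on `input` after at most `t` steps with output `w`. -/
def OutputsWithin (M : RATM I O) (input : List I) (w : List O) (t : ℕ) : Prop :=
  ∃ s ≤ t, M.action input ((M.step input)^[s] M.init) = none ∧
    ∀ i : ℕ, ((M.step input)^[s] M.init).tape 0 i = (w[i]?).map M.outSym

end RATM

/-! ## Functions computable in pseudo-sublinear time -/

/-- The input tape for a data string and a problem string: `D # P`, with a separator `#` that
occurs in neither of them. -/
def pairInput (D P : List Letter) : List (Letter ⊕ Unit) :=
  D.map Sum.inl ++ Sum.inr () :: P.map Sum.inl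

/-- `prep` is computable in polynomial time. -/
def PTimeComputable (prep : List Letter → List Letter) : Prop :=
  Nonempty (Turing.TM2ComputableInPolyTime (fun x : List Letter => x) (fun x : List Letter => x) prep)

/-- `g` is computable in pseudo-sublinear time: after a polynomial-time preprocessing `prep` of the
data part `x`, a random-access Turing machine computes `g x y` from `prep x` and `y` in time
`o(|x|)`, whatever the problem part `y` is. -/
def PsTComputable (g : List Letter → List Letter → List Letter) : Prop :=
  ∃ prep : List Letter → List Letter, PTimeComputable prep ∧
    ∃ (M : RATM (Letter ⊕ Unit) Letter) (t : ℕ → ℕ),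
      ((fun n : ℕ => (t n : ℝ)) =o[atTop] fun n : ℕ => (n : ℝ)) ∧
      ∀ x y : List Letter, M.OutputsWithin (pairInput (prep x) y) (g x y) (t x.length)

/-! ## Parallel random-access machines and NC -/

/-- Instructions of a parallel random-access machine. Processors have local registers `R`, and
share a read-only input array, a memory and an output array. -/
inductive PInstr : Type
  /-- `R[r] := c` -/
  | const (r c : ℕ)
  /-- `R[r] := R[a] + R[b]` -/
  | add (r a b : ℕ)
  /-- `R[r] := R[a] - R[b]`, or `0` if this is negative -/
  | sub (r a b : ℕ)
  /-- `R[r] := ⌊R[a] / 2⌋` -/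
  | half (r a : ℕ)
  /-- `R[r] :=` number of the processor -/
  | pid (r : ℕ)
  /-- `R[r] :=` length of the input -/
  | len (r : ℕ)
  /-- `R[r] :=` code of the input symbol at position `R[a]`, or `0` beyond the end -/
  | input (r a : ℕ)
  /-- `R[r] := memory[R[a]]` -/
  | load (r a : ℕ)
  /-- `memory[R[a]] := R[r]` -/
  | store (a r : ℕ)
  /-- `output[R[a]] := R[r]` -/
  | output (a r : ℕ)
  /-- go to instruction `l` if `R[r] = 0` -/
  | jz (r l : ℕ)

/-- Configurations: program counter and registers of every processor, memory and output. -/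
structure PConfig where
  pc : ℕ → ℕ
  reg : ℕ → ℕ → ℕ
  mem : ℕ → ℕ
  out : ℕ → ℕ

namespace PRAM

/-- Everything is `0` at the start. -/
def init : PConfig := ⟨fun _ => 0, fun _ _ => 0, fun _ => 0, fun _ => 0⟩

/-- The instruction that processor `p` executes next; `none` if it has halted, which it does by
leaving the program. -/
def instr (prog : List PInstr) (c : PConfig) (p : ℕ) : Option PInstr := prog[c.pc p]?

/-- The new registers of processor `p`. -/
def stepReg (prog : List PInstr) (x : List Letter) (c : PConfig) (p : ℕ) : ℕ → ℕ :=
  let R := c.reg p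
  match instr prog c p with
  | some (.const r v) => Function.update R r v
  | some (.add r a b) => Function.update R r (R a + R b)
  | some (.sub r a b) => Function.update R r (R a - R b)
  | some (.half r a) => Function.update R r (R a / 2)
  | some (.pid r) => Function.update R r p
  | some (.len r) => Function.update R r x.length
  | some (.input r a) => Function.update R r ((x[R a]?).elim 0 Letter.code)
  | some (.load r a) => Function.update R r (c.mem (R a))
  | _ => R

/-- The new program counter of processor `p`. -/
def stepPc (prog : List PInstr) (c : PConfig) (p : ℕ) : ℕ :=
  match instr prog c p with
  | none => c.pc p
  | some (.jz r l) => if c.reg p r = 0 then l else c.pc p + 1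
  | some _ => c.pc p + 1

/-- The value that processor `p` writes to memory cell `a` in this step, if it does so. -/
def memWrite (prog : List PInstr) (c : PConfig) (a p : ℕ) : Option ℕ :=
  match instr prog c p with
  | some (.store b r) => if c.reg p b = a then some (c.reg p r) else none
  | _ => none

/-- The value that processor `p` writes to output cell `a` in this step, if it does so. -/
def outWrite (prog : List PInstr) (c : PConfig) (a p : ℕ) : Option ℕ :=
  match instr prog c p with
  | some (.output b r) => if c.reg p b = a then some (c.reg p r) else none
  | _ => none

/-- One synchronous step of the processors `0, …, procs - 1`: all reads come before all writes,
and the lowest-numbered processor succeeds in a write conflict. -/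
def step (prog : List PInstr) (procs : ℕ) (x : List Letter) (c : PConfig) : PConfig where
  pc p := if p < procs then stepPc prog c p else c.pc p
  reg p := if p < procs then stepReg prog x c p else c.reg p
  mem a := ((List.range procs).findSome? (memWrite prog c a)).getD (c.mem a)
  out a := ((List.range procs).findSome? (outWrite prog c a)).getD (c.out a)

/-- With `procs` processors the program halts on `x` after at most `t` steps with output `w`: the
output array holds the codes of `w`, followed by a `0`. -/
def OutputsWithin (prog : List PInstr) (procs : ℕ) (x w : List Letter) (t : ℕ) : Prop :=
  ∃ s ≤ t,
    let c := (step prog procs x)^[s] init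
    (∀ p < procs, instr prog c p = none) ∧
      ∀ i ≤ w.length, c.out i = (w[i]?).elim 0 Letter.code

end PRAM

/-- `f` is computable in NC: by a parallel random-access machine with polynomially many processors
in polylogarithmic time. -/
def NCComputable (f : List Letter → List Letter) : Prop :=
  ∃ (prog : List PInstr) (k : ℕ), ∀ x : List Letter,
    PRAM.OutputsWithin prog (x.length ^ k + k) x (f x) (k * Nat.log 2 x.length ^ k + k)

/-- `f` is a linear-size NC computable function: moreover `|f x| = O(|x|)`. -/
def LinearSizeNC (f : List Letter → List Letter) : Prop :=
  NCComputable f ∧ ∃ c : ℕ, ∀ x : List Letter, (f x).length ≤ c * x.length + c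

/-! ## The reduction -/

/-- Pseudo-sublinear-time reducibility. -/
def PsTReducible (𝒫₁ 𝒫₂ : Problem) : Prop :=
  ∃ (f₁ f₂ : List Letter → List Letter) (g : List Letter → List Letter → List Letter),
    LinearSizeNC f₁ ∧ LinearSizeNC f₂ ∧ PsTComputable g ∧
      ∀ D P : List Letter, 𝒫₁ D P ↔ 𝒫₂ (f₁ D) (g (f₂ D) P)

/-! ## The circuit value problem -/

/-- A bit as a symbol. -/
def bitSym (b : Bool) : Letter := if b then .b1 else .b0

/-- Binary representation of a natural number, least significant digit first and without
superfluous zeros (so that `0` is the empty string of digits). -/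
def numeral (n : ℕ) : List Letter := n.bits.map bitSym

/-- Non-input gates; the arguments are node numbers. -/
inductive Gate : Type
  | and (u v : ℕ)
  | or (u v : ℕ)
  | not (u : ℕ)

namespace Gate

/-- The arguments are nodes with numbers below `n`. -/
def RefsBelow (n : ℕ) : Gate → Prop
  | and u v => u < n ∧ v < n
  | or u v => u < n ∧ v < n
  | not u => u < n

/-- Value of a gate, given the values of the earlier nodes. -/
def eval (vals : List Bool) : Gate → Bool
  | and u v => vals.getD u false && vals.getD v false
  | or u v => vals.getD u false || vals.getD v false
  | not u => !vals.getD u false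

def encode : Gate → List Letter
  | and u v => .conj :: numeral u ++ .comma :: numeral v
  | or u v => .disj :: numeral u ++ .comma :: numeral v
  | not u => .neg :: numeral u

end Gate

/-- A Boolean circuit: the nodes `0, …, inputs - 1` are the inputs, the node `inputs + j` is the
gate `gates[j]`, and the last node is the output. -/
structure Circuit where
  inputs : ℕ
  gates : List Gate

namespace Circuit

/-- There is an output node, and every gate takes its arguments from nodes with smaller numbers. -/
def WellFormed (C : Circuit) : Prop :=
  0 < C.inputs + C.gates.length ∧
    ∀ (j : ℕ) (γ : Gate), C.gates[j]? = some γ → γ.RefsBelow (C.inputs + j)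

/-- The values of all nodes on input `x`. -/
def vals (C : Circuit) (x : List Bool) : List Bool :=
  C.gates.foldl (fun vs γ => vs ++ [γ.eval vs]) x

/-- The output is `TRUE` on input `x`. -/
def Accepts (C : Circuit) (x : List Bool) : Prop := (C.vals x).getLast? = some true

/-- The circuit as a string: the list of all nodes, each with its number, its kind and its
arguments. -/
def encode (C : Circuit) : List Letter :=
  (List.range C.inputs).flatMap (fun i => numeral i ++ [.inp, .fin]) ++
    (C.gates.mapIdx fun j γ => numeral (C.inputs + j) ++ γ.encode ++ [.fin]).flatten

end Circuit

/-- The circuit value problem: the data part is a circuit, the problem part consists of the values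
of its inputs. -/
def CVP : Problem := fun D P =>
  ∃ (C : Circuit) (x : List Bool), C.WellFormed ∧ x.length = C.inputs ∧
    D = C.encode ∧ P = x.map bitSym ∧ C.Accepts x

/-! ## The algebraic equation root problem -/

/-- Integer polynomial expressions in previously defined quantities. -/
inductive ArithTerm : Type
  | node (u : ℕ)
  | lit (c : ℤ)
  | add (s t : ArithTerm)
  | sub (s t : ArithTerm)
  | mul (s t : ArithTerm)

/-- An integer as a string. -/
def intSym : ℤ → List Letter
  | .ofNat n => .pos :: numeral n
  | .negSucc n => .ngt :: numeral (n + 1)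

namespace ArithTerm

/-- All referenced nodes have numbers below `n`. -/
def RefsBelow (n : ℕ) : ArithTerm → Prop
  | node u => u < n
  | lit _ => True
  | add s t => s.RefsBelow n ∧ t.RefsBelow n
  | sub s t => s.RefsBelow n ∧ t.RefsBelow n
  | mul s t => s.RefsBelow n ∧ t.RefsBelow n

/-- Value of an expression, given the values of the nodes. -/
def eval (vals : List ℤ) : ArithTerm → ℤ
  | node u => vals.getD u 0
  | lit c => c
  | add s t => s.eval vals + t.eval vals
  | sub s t => s.eval vals - t.eval vals
  | mul s t => s.eval vals * t.eval vals

/-- Prefix notation. -/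
def encode : ArithTerm → List Letter
  | node u => .ref :: numeral u
  | lit c => intSym c
  | add s t => .plus :: s.encode ++ t.encode
  | sub s t => .minus :: s.encode ++ t.encode
  | mul s t => .times :: s.encode ++ t.encode

end ArithTerm

/-- An algebraic equation in the variables `x₁, …, x_d`, `d = vars`, with integer coefficients.
Its polynomials are given by an arithmetic straight-line program: the node `i < d` is the
variable `x_{i+1}`, the node `d + j` abbreviates the expression `defs[j]` in the earlier nodes,
and the equation is `lhs = rhs`. -/
structure AlgEquation where
  vars : ℕ
  defs : List ArithTerm
  lhs : ArithTerm
  rhs : ArithTerm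

namespace AlgEquation

/-- Every definition uses only earlier nodes, and the two sides use only existing ones. -/
def WellFormed (E : AlgEquation) : Prop :=
  (∀ (j : ℕ) (s : ArithTerm), E.defs[j]? = some s → s.RefsBelow (E.vars + j)) ∧
    E.lhs.RefsBelow (E.vars + E.defs.length) ∧ E.rhs.RefsBelow (E.vars + E.defs.length)

/-- The values of all nodes under the assignment `A`. -/
def vals (E : AlgEquation) (A : List ℤ) : List ℤ :=
  E.defs.foldl (fun vs s => vs ++ [s.eval vs]) A

/-- The assignment `A` is a root of the equation. -/
def IsRoot (E : AlgEquation) (A : List ℤ) : Prop :=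
  E.lhs.eval (E.vals A) = E.rhs.eval (E.vals A)

/-- The equation as a string. -/
def encode (E : AlgEquation) : List Letter :=
  (List.range E.vars).flatMap (fun i => numeral i ++ [.inp, .fin]) ++
    (E.defs.mapIdx fun j s => numeral (E.vars + j) ++ .asg :: s.encode ++ [.fin]).flatten ++
    .eql :: E.lhs.encode ++ E.rhs.encode ++ [.fin]

end AlgEquation

/-- A string without its blanks. -/
def eraseBlanks (x : List Letter) : List Letter := x.filter (· ≠ .blank)

/-- The algebraic equation root problem: the data part is an algebraic equation, the problem part
is an assignment of integers to its variables. Blanks in the two strings are ignored. -/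
def AERP : Problem := fun D P =>
  ∃ (E : AlgEquation) (A : List ℤ), E.WellFormed ∧ A.length = E.vars ∧
    eraseBlanks D = E.encode ∧ eraseBlanks P = A.flatMap intSym ∧ E.IsRoot A

/-! ## Unique readability -/

/-! On the values 0 and 1 each gate agrees with a polynomial: `uv`, `1 - (1 - u)(1 - v)` or `1 - u`.
A circuit thus becomes a straight-line program, and acceptance becomes the equation "last node = 1"
(`Circuit.isRoot_toEquation`). The work lies in the resource bounds and in the strings that encode
no circuit.

Data parts. `reduction` is a local transducer: every symbol of `D`, and the end of `D`, contributes
a block of at most nine letters, determined by the symbol, its right neighbour and the nearest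
non-digit to its left, which is sought through logarithmically many digits only. Blanks give all
blocks the same length, so their addresses are known in advance and processors that never
communicate can write them in logarithmic time (`linearSizeNC_reduction`). Three passes over `D`
produce the node list with the equality sign, the operators of the left side, and its operands
followed by the right side. The left side is not a plain reference to the last node, since the left
context of a digit does not show whether its record is the last one. Instead `chainTerm` mentions
every node and multiplies all but the last by 0, so that the numbers of all records are copied by
one rule.

If `D` is not a circuit, its translation must not be an equation either. Misplaced symbols become
commas, which occur in no equation, and unique readability of prefix terms allows the node list to
be read backwards to a circuit (`exists_circuit_of_transduce`).

Problem parts. Bits become the integers 0 and 1, but the time must be sublinear in the data part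
even for a very long problem part. As the input records carry their numbers in binary, a circuit of
length n has only O(n / log n) inputs. The function `rounds` exceeds the number of inputs
(`lt_rounds`), is o(n) (`isLittleO_rounds`) and is found in polynomial time by a binary counter. The
preprocessing writes it in unary, and the random-access machine translates at most that many bits. A
problem part that gets truncated still has too many values, so the answer remains negative
(`cvp_iff_aerp`). -/

/-- The string does not begin with a digit. -/
def NoDigitHead (r : List Letter) : Prop := ∀ (b : Bool) (z : List Letter), r ≠ bitSym b :: z

theorem bitSym_injective : Function.Injective bitSym := by
  intro a b; cases a <;> cases b <;> simp [bitSym]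

theorem noDigitHead_cons {a : Letter} {r : List Letter} (h : ∀ b, a ≠ bitSym b) :
    NoDigitHead (a :: r) := fun b _ e => h b (List.cons.inj e).1

/-- Numerals have no end mark; they are delimited by the first letter that is not a digit. Hence the
side conditions on the remainders here and below. -/
theorem digits_append_inj : ∀ {w w' : List Bool} {r r' : List Letter}, NoDigitHead r →
    NoDigitHead r' → w.map bitSym ++ r = w'.map bitSym ++ r' → w = w' ∧ r = r'
  | [], [], _, _, _, _, h => ⟨rfl, h⟩
  | [], b :: w', _, _, hr, _, h => absurd h (hr b _)
  | b :: w, [], _, _, _, hr', h => absurd h.symm (hr' b _)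
  | b :: w, b' :: w', _, _, hr, hr', h => by
    simp only [List.map_cons, List.cons_append, List.cons.injEq] at h
    obtain ⟨h₁, h₂⟩ := digits_append_inj hr hr' h.2
    exact ⟨by rw [bitSym_injective h.1, h₁], h₂⟩

theorem bits_injective : Function.Injective Nat.bits := fun m n h => by
  have := congrArg (fun l => Nat.ofDigits 2 (l.map fun b => cond b 1 0)) h
  simpa [← Nat.digits_two_eq_bits, Nat.ofDigits_digits] using this

theorem numeral_append_inj {m n : ℕ} {r r' : List Letter} (hr : NoDigitHead r)
    (hr' : NoDigitHead r') (h : numeral m ++ r = numeral n ++ r') : m = n ∧ r = r' := by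
  obtain ⟨h₁, h₂⟩ := digits_append_inj hr hr' h
  exact ⟨bits_injective h₁, h₂⟩

namespace ArithTerm

theorem noDigitHead_encode (s : ArithTerm) (r : List Letter) : NoDigitHead (s.encode ++ r) := by
  cases s with
  | lit c => cases c <;> (intro b _; cases b <;> simp [encode, intSym, bitSym])
  | _ => intro b _; cases b <;> simp [encode, bitSym]

/-- In prefix notation the first letter fixes the constructor. The remainder after a first operand
is a second operand, which never begins with a digit, so the induction hypothesis applies to both
operands. -/
theorem encode_append_inj : ∀ {s t : ArithTerm} {r r' : List Letter}, NoDigitHead r →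
    NoDigitHead r' → s.encode ++ r = t.encode ++ r' → s = t ∧ r = r' := by
  intro s
  induction s with
  | node u =>
    intro t r r' hr hr' h
    cases t with
    | node v =>
      simp only [encode, List.cons_append, List.cons.injEq, true_and] at h
      obtain ⟨rfl, rfl⟩ := numeral_append_inj hr hr' h
      exact ⟨rfl, rfl⟩
    | lit c => cases c <;> simp [encode, intSym] at h
    | _ => simp [encode] at h
  | lit c =>
    intro t r r' hr hr' h
    cases t with
    | lit c' =>
      cases c <;> cases c' <;>
        simp only [encode, intSym, List.cons_append, List.cons.injEq, true_and, reduceCtorEq,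
          false_and] at h
      · obtain ⟨rfl, rfl⟩ := numeral_append_inj hr hr' h
        exact ⟨rfl, rfl⟩
      · obtain ⟨h', rfl⟩ := numeral_append_inj hr hr' h
        exact ⟨by rw [Nat.succ.inj h'], rfl⟩
    | _ => cases c <;> simp [encode, intSym] at h
  | add s₁ s₂ ih₁ ih₂ | sub s₁ s₂ ih₁ ih₂ | mul s₁ s₂ ih₁ ih₂ =>
    intro t r r' hr hr' h
    cases t with
    | lit c => cases c <;> simp [encode, intSym] at h
    | node v => simp [encode] at h
    | _ =>
      simp only [encode, List.cons_append, List.append_assoc, List.cons.injEq, true_and,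
        reduceCtorEq, false_and] at h
      try
        obtain ⟨rfl, h'⟩ := ih₁ (noDigitHead_encode _ _) (noDigitHead_encode _ _) h
        obtain ⟨rfl, rfl⟩ := ih₂ hr hr' h'
        exact ⟨rfl, rfl⟩

theorem encode_append_eq_ref {s : ArithTerm} {r z : List Letter}
    (h : s.encode ++ r = .ref :: z) : ∃ u, s = node u ∧ z = numeral u ++ r := by
  cases s with
  | node u => exact ⟨u, rfl, by simpa [encode, eq_comm] using h⟩
  | lit c => cases c <;> simp [encode, intSym] at h
  | _ => simp [encode] at h

theorem encode_append_eq_minus {s : ArithTerm} {r z : List Letter}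
    (h : s.encode ++ r = .minus :: z) :
    ∃ s₁ s₂, s = sub s₁ s₂ ∧ s₁.encode ++ (s₂.encode ++ r) = z := by
  cases s with
  | sub s₁ s₂ => exact ⟨s₁, s₂, rfl, by simpa [encode] using h⟩
  | lit c => cases c <;> simp [encode, intSym] at h
  | _ => simp [encode] at h

theorem encode_append_eq_times {s : ArithTerm} {r z : List Letter}
    (h : s.encode ++ r = .times :: z) :
    ∃ s₁ s₂, s = mul s₁ s₂ ∧ s₁.encode ++ (s₂.encode ++ r) = z := by
  cases s with
  | mul s₁ s₂ => exact ⟨s₁, s₂, rfl, by simpa [encode] using h⟩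
  | lit c => cases c <;> simp [encode, intSym] at h
  | _ => simp [encode] at h

theorem encode_append_eq_one {s : ArithTerm} {r z : List Letter} {a : Letter}
    (ha : ∀ b, a ≠ bitSym b) (hr : NoDigitHead r)
    (h : s.encode ++ r = .pos :: .b1 :: a :: z) : s = lit 1 ∧ r = a :: z := by
  have : s.encode ++ r = (lit 1).encode ++ (a :: z) := h
  exact encode_append_inj hr (noDigitHead_cons ha) this

end ArithTerm

theorem flatMap_intSym_injective : ∀ {A B : List ℤ},
    A.flatMap intSym = B.flatMap intSym → A = B
  | [], [], _ => rfl
  | [], c :: B, h => by cases c <;> simp [intSym] at h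
  | c :: A, [], h => by cases c <;> simp [intSym] at h
  | c :: A, c' :: B, h => by
    have aux : ∀ A : List ℤ, NoDigitHead (A.flatMap intSym) := by
      intro A b z e
      cases A with
      | nil => simp at e
      | cons c A => cases c <;> cases b <;> simp [intSym, bitSym] at e
    have h' : (ArithTerm.lit c).encode ++ A.flatMap intSym =
      (ArithTerm.lit c').encode ++ B.flatMap intSym := by simpa [ArithTerm.encode] using h
    obtain ⟨h₁, h₂⟩ := ArithTerm.encode_append_inj (aux A) (aux B) h'
    rw [ArithTerm.lit.inj h₁, flatMap_intSym_injective h₂]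

/-! ## Translating circuits into equations -/

open ArithTerm in
/-- The polynomial that agrees with the gate on the values `0` and `1`. -/
def Gate.toTerm : Gate → ArithTerm
  | and u v => mul (node u) (node v)
  | or u v => sub (lit 1) (mul (sub (lit 1) (node u)) (sub (lit 1) (node v)))
  | not u => sub (lit 1) (node u)

/-- A term with the value of the node `k`, in which every node up to `k` occurs. -/
def chainTerm : ℕ → ArithTerm
  | 0 => .node 0
  | k + 1 => .add (.mul (chainTerm k) (.lit 0)) (.node (k + 1))

/-- The equation `output = 1`. -/
def Circuit.toEquation (C : Circuit) : AlgEquation where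
  vars := C.inputs
  defs := C.gates.map Gate.toTerm
  lhs := chainTerm (C.inputs + C.gates.length - 1)
  rhs := .lit 1

/-- Truth values as integers. -/
def boolInt (b : Bool) : ℤ := if b then 1 else 0

theorem Gate.eval_toTerm (γ : Gate) (vs : List Bool) :
    γ.toTerm.eval (vs.map boolInt) = boolInt (γ.eval vs) := by
  -- The default values `false` and `0` correspond under `boolInt`, so no bound on the references is
  -- needed.
  have key : ∀ u, (vs.map boolInt).getD u 0 = boolInt (vs.getD u false) := fun u => by
    simpa [boolInt] using List.getD_map (l := vs) (n := u) (d := false) boolInt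
  cases γ <;> simp only [toTerm, ArithTerm.eval, Gate.eval, key]
  · rename_i u v; cases vs.getD u false <;> cases vs.getD v false <;> rfl
  · rename_i u v; cases vs.getD u false <;> cases vs.getD v false <;> rfl
  · rename_i u; cases vs.getD u false <;> rfl

theorem Gate.refsBelow_toTerm (γ : Gate) (n : ℕ) : γ.toTerm.RefsBelow n ↔ γ.RefsBelow n := by
  cases γ <;> simp [toTerm, ArithTerm.RefsBelow, RefsBelow]

theorem chainTerm_refsBelow {k n : ℕ} : (chainTerm k).RefsBelow n ↔ k < n := by
  induction k with
  | zero => simp [chainTerm, ArithTerm.RefsBelow]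
  | succ k ih => simp only [chainTerm, ArithTerm.RefsBelow, ih, and_true]; omega

theorem chainTerm_eval (k : ℕ) (vs : List ℤ) : (chainTerm k).eval vs = vs.getD k 0 := by
  cases k <;> simp [chainTerm, ArithTerm.eval]

theorem Circuit.vals_toEquation (C : Circuit) (x : List Bool) :
    C.toEquation.vals (x.map boolInt) = (C.vals x).map boolInt := by
  have : ∀ (gs : List Gate) (x : List Bool),
      (gs.map Gate.toTerm).foldl (fun vs s => vs ++ [s.eval vs]) (x.map boolInt) =
        (gs.foldl (fun vs γ => vs ++ [γ.eval vs]) x).map boolInt := by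
    intro gs
    induction gs with
    | nil => simp
    | cons γ gs ih =>
      intro x
      rw [List.map_cons, List.foldl_cons, List.foldl_cons, ← ih]
      simp [Gate.eval_toTerm]
  exact this C.gates x

theorem Circuit.length_vals (C : Circuit) (x : List Bool) :
    (C.vals x).length = x.length + C.gates.length := by
  have : ∀ (gs : List Gate) (x : List Bool),
      (gs.foldl (fun vs γ => vs ++ [γ.eval vs]) x).length = x.length + gs.length := by
    intro gs
    induction gs with
    | nil => simp
    | cons γ gs ih => intro x; rw [List.foldl_cons, ih]; simp; omega
  exact this C.gates x

theorem Circuit.isRoot_toEquation (C : Circuit) (hC : C.WellFormed) (x : List Bool)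
    (hx : x.length = C.inputs) : C.toEquation.IsRoot (x.map boolInt) ↔ C.Accepts x := by
  have hl := C.length_vals x
  have h0 := hC.1
  unfold AlgEquation.IsRoot Accepts
  rw [C.vals_toEquation]
  simp only [toEquation, chainTerm_eval, ArithTerm.eval]
  rw [List.getLast?_eq_getElem?, List.getD_eq_getElem?_getD, hl, hx, List.getElem?_map]
  have hlt : C.inputs + C.gates.length - 1 < (C.vals x).length := by omega
  rw [List.getElem?_eq_getElem hlt]
  cases (C.vals x)[C.inputs + C.gates.length - 1] <;> simp [boolInt]

/-- The existence of an output node is also reflected: without nodes the truncated subtraction gives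
`chainTerm 0`, which refers to a missing node `0`. -/
theorem Circuit.wellFormed_toEquation (C : Circuit) : C.toEquation.WellFormed ↔ C.WellFormed := by
  simp only [AlgEquation.WellFormed, toEquation, WellFormed, chainTerm_refsBelow, List.length_map,
    ArithTerm.RefsBelow, and_true, List.getElem?_map, Option.map_eq_some_iff]
  rw [and_comm]
  refine and_congr ⟨fun h => by omega, fun h => by omega⟩ ⟨fun h j γ hj => ?_, ?_⟩
  · exact (γ.refsBelow_toTerm _).1 (h j _ ⟨γ, hj, rfl⟩)
  · rintro h j _ ⟨γ, hj, rfl⟩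
    exact (γ.refsBelow_toTerm _).2 (h j γ hj)

/-! ## Node lists as concatenations of records -/

/-- The gates as a string, numbered from `k`. -/
def gateRecords : ℕ → List Gate → List Letter
  | _, [] => []
  | k, γ :: gs => numeral k ++ (γ.encode ++ .fin :: gateRecords (k + 1) gs)

/-- The definitions as a string, numbered from `k`. -/
def defRecords : ℕ → List ArithTerm → List Letter
  | _, [] => []
  | k, s :: ss => numeral k ++ .asg :: (s.encode ++ .fin :: defRecords (k + 1) ss)

/-- The inputs `i, …, i + m - 1` as a string. -/
def inputRecords : ℕ → ℕ → List Letter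
  | _, 0 => []
  | i, m + 1 => numeral i ++ .inp :: .fin :: inputRecords (i + 1) m

theorem flatMap_range_inputs (m : ℕ) : ((List.range m).flatMap fun i => numeral i ++ [.inp, .fin]) =
    inputRecords 0 m := by
  have : ∀ m i, ((List.range m).flatMap fun j => numeral (i + j) ++ [.inp, .fin]) =
      inputRecords i m := by
    intro m
    induction m with
    | zero => simp [inputRecords]
    | succ m ih =>
      intro i
      rw [List.range_succ_eq_map, List.flatMap_cons, List.flatMap_map, inputRecords, ← ih]
      simp [Nat.add_comm, Nat.add_left_comm]
  simpa using this m 0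

theorem Circuit.encode_eq (C : Circuit) :
    C.encode = inputRecords 0 C.inputs ++ gateRecords C.inputs C.gates := by
  have : ∀ (gs : List Gate) k,
      (gs.mapIdx fun j γ => numeral (k + j) ++ γ.encode ++ [.fin]).flatten = gateRecords k gs := by
    intro gs
    induction gs with
    | nil => simp [gateRecords]
    | cons γ gs ih =>
      intro k
      rw [List.mapIdx_cons, List.flatten_cons, gateRecords, ← ih]
      simp [Nat.add_comm, Nat.add_left_comm]
  rw [encode, this, flatMap_range_inputs]

theorem AlgEquation.encode_eq (E : AlgEquation) :
    E.encode = inputRecords 0 E.vars ++ (defRecords E.vars E.defs ++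
      .eql :: (E.lhs.encode ++ (E.rhs.encode ++ [.fin]))) := by
  have : ∀ (gs : List ArithTerm) k,
      (gs.mapIdx fun j γ => numeral (k + j) ++ .asg :: γ.encode ++ [.fin]).flatten =
        defRecords k gs := by
    intro gs
    induction gs with
    | nil => simp [defRecords]
    | cons γ gs ih =>
      intro k
      rw [List.mapIdx_cons, List.flatten_cons, defRecords, ← ih]
      simp [Nat.add_comm, Nat.add_left_comm]
  rw [encode, this, flatMap_range_inputs]
  simp

/-! ## The transducer -/

/-- The code of the nearest symbol that is not a digit, in a string read from its head; `0` if
there is none. The search is given up after `k` digits, with the code of the last digit. -/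
def scan : ℕ → ℕ → List Letter → ℕ
  | s, 0, _ => s
  | _, _ + 1, [] => 0
  | _, k + 1, a :: l => if a.code ≤ 2 then scan a.code k l else a.code

/-- The translation of a symbol inside a node list, given the code of the nearest non-digit to
its left. A misplaced symbol gives a comma. -/
def defBlock (s : ℕ) : Option Letter → List Letter
  | none => [.eql]
  | some .b0 => [.b0]
  | some .b1 => [.b1]
  | some .inp => [.inp]
  | some .fin => [.fin]
  | some .conj => [.asg, .times, .ref]
  | some .disj => [.asg, .minus, .pos, .b1, .times, .minus, .pos, .b1, .ref]
  | some .neg => [.asg, .minus, .pos, .b1, .ref]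
  | some .comma => if s = 4 then [.ref] else if s = 5 then [.minus, .pos, .b1, .ref] else [.comma]
  | some _ => [.comma]

/-- The contribution of a symbol to the operators of the chain term. -/
def opBlock (next : Option Letter) : Option Letter → List Letter
  | none => [.ref]
  | some .fin => if next.isSome then [.plus, .times] else []
  | some _ => []

/-- The contribution of a symbol to the node references of the chain term. -/
def refBlock (s : ℕ) (next : Option Letter) : Option Letter → List Letter
  | none => [.pos, .b1, .fin]
  | some .fin => if next.isSome then [.pos, .ref] else []
  | some .b0 => if s = 0 ∨ s = 8 then [.b0] else []
  | some .b1 => if s = 0 ∨ s = 8 then [.b1] else []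
  | some _ => []

/-- The block of a symbol in the part `r` of the translated string. -/
def areaBlock (r s : ℕ) (o next : Option Letter) : List Letter :=
  if r = 0 then defBlock s o else if r = 1 then opBlock next o else refBlock s next o

/-- Concatenation of the blocks of all symbols and of the end of the string; `pre` is what
precedes the string, reversed. -/
def transduce (k r : ℕ) : List Letter → List Letter → List Letter
  | pre, [] => areaBlock r (scan 1 k pre) none none
  | pre, a :: l => areaBlock r (scan 1 k pre) (some a) l.head? ++ transduce k r (a :: pre) l

theorem code_bitSym_le (b : Bool) : (bitSym b).code ≤ 2 := by cases b <;> decide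

/-- A search that gives up returns the code 1 or 2 of a digit. The rules of the transducer test for
0, 4, 5 and 8 only, so an abandoned search is never mistaken for a genuine context. -/
theorem scan_digits (w : List Bool) (a : Letter) (ha : 2 < a.code) (pre : List Letter) :
    ∀ {s k : ℕ}, 1 ≤ s ∧ s ≤ 2 → scan s k (w.map bitSym ++ a :: pre) = a.code ∨
      (k ≤ w.length ∧ 1 ≤ scan s k (w.map bitSym ++ a :: pre) ∧
        scan s k (w.map bitSym ++ a :: pre) ≤ 2) := by
  induction w with
  | nil =>
    rintro s (_ | k) hs
    · right; simp [scan]; omega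
    · left; simp [scan]; omega
  | cons b w ih =>
    rintro s (_ | k) hs
    · right; simp [scan]; omega
    · simpa [scan, code_bitSym_le] using
        ih (s := (bitSym b).code) (k := k) ⟨by cases b <;> decide, code_bitSym_le b⟩

theorem scan_digits_nil (w : List Bool) : ∀ {s k : ℕ}, w.length < k →
    scan s k (w.map bitSym) = 0 := by
  induction w with
  | nil =>
    rintro s (_ | k) hs
    · simp at hs
    · simp [scan]
  | cons b w ih =>
    rintro s (_ | k) hs
    · simp at hs
    · simpa [scan, code_bitSym_le] using ih (by simpa using hs)

theorem scan_numeral (u : ℕ) (a : Letter) (ha : 2 < a.code) (pre : List Letter) (k : ℕ) :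
    scan 1 k ((numeral u).reverse ++ a :: pre) = a.code ∨
      (k ≤ u.size ∧ scan 1 k ((numeral u).reverse ++ a :: pre) ≤ 2) := by
  have := scan_digits u.bits.reverse a ha pre (s := 1) (k := k) (by decide)
  rw [List.length_reverse, Nat.size_eq_bits_len, List.map_reverse] at this
  unfold numeral
  omega

/-! ### Reading a translated node list -/

section Parse

variable {k : ℕ} {pre l Y z : List Letter}

/-- In the node list no block is empty, and the first letter of a block determines the source symbol
whenever it is a digit, `inp`, `fin` or `eql`. This and the next lemmas invert the translation one
block at a time; only `asg` leaves a choice, between the three kinds of gates. -/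
theorem transduce_eq_bit {b : Bool} (h : transduce k 0 pre l ++ Y = bitSym b :: z) :
    ∃ l', l = bitSym b :: l' ∧ transduce k 0 (bitSym b :: pre) l' ++ Y = z := by
  cases l with
  | nil => cases b <;> simp [transduce, areaBlock, defBlock, bitSym] at h
  | cons a l =>
    refine ⟨l, ?_⟩
    cases a <;> cases b <;> simp [transduce, areaBlock, defBlock, bitSym] at h ⊢ <;>
      first | exact h | (split_ifs at h <;> simp at h)

theorem transduce_eq_numeral {n : ℕ} (h : transduce k 0 pre l ++ Y = numeral n ++ z) :
    ∃ l', l = numeral n ++ l' ∧ transduce k 0 ((numeral n).reverse ++ pre) l' ++ Y = z := by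
  unfold numeral at *
  generalize n.bits = w at *
  induction w generalizing pre l with
  | nil => exact ⟨l, rfl, h⟩
  | cons b w ih =>
    obtain ⟨l₁, rfl, h₁⟩ := transduce_eq_bit h
    obtain ⟨l₂, rfl, h₂⟩ := ih h₁
    exact ⟨l₂, rfl, by simpa using h₂⟩

theorem transduce_eq_inp (h : transduce k 0 pre l ++ Y = .inp :: z) :
    ∃ l', l = .inp :: l' ∧ transduce k 0 (.inp :: pre) l' ++ Y = z := by
  cases l with
  | nil => simp [transduce, areaBlock, defBlock] at h
  | cons a l =>
    refine ⟨l, ?_⟩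
    cases a <;> simp [transduce, areaBlock, defBlock] at h ⊢ <;>
      first | exact h | (split_ifs at h <;> simp at h)

theorem transduce_eq_fin (h : transduce k 0 pre l ++ Y = .fin :: z) :
    ∃ l', l = .fin :: l' ∧ transduce k 0 (.fin :: pre) l' ++ Y = z := by
  cases l with
  | nil => simp [transduce, areaBlock, defBlock] at h
  | cons a l =>
    refine ⟨l, ?_⟩
    cases a <;> simp [transduce, areaBlock, defBlock] at h ⊢ <;>
      first | exact h | (split_ifs at h <;> simp at h)

theorem transduce_eq_eql (h : transduce k 0 pre l ++ Y = .eql :: z) : l = [] ∧ Y = z := by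
  cases l with
  | nil => simpa [transduce, areaBlock, defBlock] using h
  | cons a l =>
    cases a <;> simp [transduce, areaBlock, defBlock] at h
    split_ifs at h <;> simp at h

theorem transduce_eq_asg (h : transduce k 0 pre l ++ Y = .asg :: z) : ∃ l',
    (l = .conj :: l' ∧ .times :: .ref :: (transduce k 0 (.conj :: pre) l' ++ Y) = z) ∨
    (l = .disj :: l' ∧ .minus :: .pos :: .b1 :: .times :: .minus :: .pos :: .b1 :: .ref ::
      (transduce k 0 (.disj :: pre) l' ++ Y) = z) ∨
    (l = .neg :: l' ∧
      .minus :: .pos :: .b1 :: .ref :: (transduce k 0 (.neg :: pre) l' ++ Y) = z) := by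
  cases l with
  | nil => simp [transduce, areaBlock, defBlock] at h
  | cons a l =>
    refine ⟨l, ?_⟩
    cases a <;> simp [transduce, areaBlock, defBlock] at h ⊢ <;>
      first | exact h | (split_ifs at h <;> simp at h)

/-- A translated string that continues with a term continues with a comma. -/
theorem transduce_eq_encode {t : ArithTerm} {r : List Letter}
    (h : transduce k 0 pre l ++ Y = t.encode ++ r) : ∃ l', l = .comma :: l' ∧
    ((scan 1 k pre = 4 ∧ .ref :: (transduce k 0 (.comma :: pre) l' ++ Y) = t.encode ++ r) ∨
    (scan 1 k pre = 5 ∧ .minus :: .pos :: .b1 :: .ref ::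
      (transduce k 0 (.comma :: pre) l' ++ Y) = t.encode ++ r)) := by
  -- Among the blocks of the node list, only those of a comma can begin with one of these letters.
  have key : ∃ a z, t.encode ++ r = a :: z ∧
      a ∈ [Letter.ref, .plus, .minus, .times, .pos, .ngt] := by
    cases t with
    | lit c => cases c <;> exact ⟨_, _, rfl, by decide⟩
    | _ => exact ⟨_, _, rfl, by decide⟩
  obtain ⟨c, z, hz, hc⟩ := key
  rw [hz] at h ⊢
  cases l with
  | nil =>
    simp only [transduce, areaBlock, defBlock, if_true, List.cons_append, List.cons.injEq] at h
    rw [← h.1] at hc; simp at hc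
  | cons a l =>
    refine ⟨l, ?_⟩
    cases a <;> simp [transduce, areaBlock, defBlock] at h ⊢ <;>
      first
        | (rw [← h.1] at hc; simp at hc)
        | (split_ifs at h with h₁ h₂
           · exact .inl ⟨h₁, by simpa using h⟩
           · exact .inr ⟨h₂, by simpa using h⟩
           · simp at h
             rw [← h.1] at hc; simp at hc)

/-- The block of the gate symbol fixes the shape of the term up to the first reference. For a binary
gate the second operand must come from a comma, and the block of that comma reveals the context it
found; by `scan_numeral` this context can only be the opening symbol of the same gate. -/
theorem transduce_eq_gate {s : ArithTerm}
    (h : transduce k 0 pre l ++ Y = .asg :: (s.encode ++ .fin :: z)) : ∃ (γ : Gate) (l' pre' : _),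
      s = γ.toTerm ∧ l = γ.encode ++ .fin :: l' ∧ transduce k 0 pre' l' ++ Y = z := by
  have hfin : NoDigitHead (.fin :: z) := noDigitHead_cons (by rintro (_ | _) <;> decide)
  have hpos : ∀ a, a = Letter.times ∨ a = Letter.minus ∨ a = Letter.ref → ∀ b, a ≠ bitSym b := by
    rintro a (rfl | rfl | rfl) (_ | _) <;> decide
  obtain ⟨l₁, ⟨rfl, h₁⟩ | ⟨rfl, h₁⟩ | ⟨rfl, h₁⟩⟩ := transduce_eq_asg h
  · obtain ⟨s₁, s₂, rfl, h₂⟩ := ArithTerm.encode_append_eq_times h₁.symm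
    obtain ⟨u, rfl, h₃⟩ := ArithTerm.encode_append_eq_ref h₂
    obtain ⟨l₂, rfl, h₄⟩ := transduce_eq_numeral h₃
    obtain ⟨l₃, rfl, ⟨-, h₅⟩ | ⟨hs, -⟩⟩ := transduce_eq_encode h₄
    · obtain ⟨v, rfl, h₆⟩ := ArithTerm.encode_append_eq_ref h₅.symm
      obtain ⟨l₄, rfl, h₇⟩ := transduce_eq_numeral h₆
      obtain ⟨l₅, rfl, h₈⟩ := transduce_eq_fin h₇
      exact ⟨.and u v, l₅, _, rfl, by simp [Gate.encode], h₈⟩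
    -- The search from this comma yields 4 or a digit code, hence not 5.
    · have := scan_numeral u .conj (by decide) pre k
      simp only [Letter.code] at this
      omega
  · obtain ⟨s₁, s₂, rfl, h₂⟩ := ArithTerm.encode_append_eq_minus h₁.symm
    obtain ⟨rfl, h₃⟩ := ArithTerm.encode_append_eq_one (hpos _ (by simp))
      (ArithTerm.noDigitHead_encode _ _) h₂
    obtain ⟨s₃, s₄, rfl, h₄⟩ := ArithTerm.encode_append_eq_times h₃
    obtain ⟨s₅, s₆, rfl, h₅⟩ := ArithTerm.encode_append_eq_minus h₄
    obtain ⟨rfl, h₆⟩ := ArithTerm.encode_append_eq_one (hpos _ (by simp))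
      (ArithTerm.noDigitHead_encode _ _) h₅
    obtain ⟨u, rfl, h₇⟩ := ArithTerm.encode_append_eq_ref h₆
    obtain ⟨l₂, rfl, h₈⟩ := transduce_eq_numeral h₇
    obtain ⟨l₃, rfl, ⟨hs, -⟩ | ⟨-, h₉⟩⟩ := transduce_eq_encode h₈
    · have := scan_numeral u .disj (by decide) pre k
      simp only [Letter.code] at this
      omega
    · obtain ⟨s₇, s₈, rfl, h₁₀⟩ := ArithTerm.encode_append_eq_minus h₉.symm
      obtain ⟨rfl, h₁₁⟩ := ArithTerm.encode_append_eq_one (hpos _ (by simp))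
        (ArithTerm.noDigitHead_encode _ _) h₁₀
      obtain ⟨v, rfl, h₁₂⟩ := ArithTerm.encode_append_eq_ref h₁₁
      obtain ⟨l₄, rfl, h₁₃⟩ := transduce_eq_numeral h₁₂
      obtain ⟨l₅, rfl, h₁₄⟩ := transduce_eq_fin h₁₃
      exact ⟨.or u v, l₅, _, rfl, by simp [Gate.encode], h₁₄⟩
  · obtain ⟨s₁, s₂, rfl, h₂⟩ := ArithTerm.encode_append_eq_minus h₁.symm
    obtain ⟨rfl, h₃⟩ := ArithTerm.encode_append_eq_one (hpos _ (by simp))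
      (ArithTerm.noDigitHead_encode _ _) h₂
    obtain ⟨u, rfl, h₄⟩ := ArithTerm.encode_append_eq_ref h₃
    obtain ⟨l₂, rfl, h₅⟩ := transduce_eq_numeral h₄
    obtain ⟨l₃, rfl, h₆⟩ := transduce_eq_fin h₅
    exact ⟨.not u, l₃, _, rfl, by simp [Gate.encode], h₆⟩

/-- The equality sign is produced by the end of the source string only, so the definitions exhaust
the source and `Y` is exactly what the other two passes have to supply. -/
theorem transduce_eq_defRecords {ss : List ArithTerm} : ∀ {n : ℕ} {pre l : List Letter},
    transduce k 0 pre l ++ Y = defRecords n ss ++ .eql :: z →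
      Y = z ∧ ∃ gs : List Gate, ss = gs.map Gate.toTerm ∧ l = gateRecords n gs := by
  induction ss with
  | nil =>
    intro n pre l h
    obtain ⟨rfl, rfl⟩ := transduce_eq_eql h
    exact ⟨rfl, [], rfl, rfl⟩
  | cons s ss ih =>
    intro n pre l h
    simp only [defRecords, List.append_assoc, List.cons_append] at h
    obtain ⟨l₁, rfl, h₁⟩ := transduce_eq_numeral h
    obtain ⟨γ, l₂, pre', rfl, rfl, h₂⟩ := transduce_eq_gate h₁
    obtain ⟨rfl, gs, rfl, rfl⟩ := ih h₂
    exact ⟨rfl, γ :: gs, rfl, rfl⟩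

theorem transduce_eq_inputRecords {m : ℕ} : ∀ {i : ℕ} {pre l : List Letter},
    transduce k 0 pre l ++ Y = inputRecords i m ++ z →
      ∃ l' pre', l = inputRecords i m ++ l' ∧ transduce k 0 pre' l' ++ Y = z := by
  induction m with
  | zero => exact fun h => ⟨_, _, rfl, h⟩
  | succ m ih =>
    intro i pre l h
    simp only [inputRecords, List.append_assoc, List.cons_append] at h
    obtain ⟨l₁, rfl, h₁⟩ := transduce_eq_numeral h
    obtain ⟨l₂, rfl, h₂⟩ := transduce_eq_inp h₁
    obtain ⟨l₃, rfl, h₃⟩ := transduce_eq_fin h₂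
    obtain ⟨l₄, pre', rfl, h₄⟩ := ih h₃
    exact ⟨l₄, pre', by simp [inputRecords], h₄⟩

/-- A string whose translation begins with the node list of an equation is a circuit. -/
theorem transduce_eq_encode_equation {E : AlgEquation}
    (h : transduce k 0 pre l ++ Y = E.encode) : ∃ C : Circuit, l = C.encode ∧
      C.inputs = E.vars ∧ E.defs = C.gates.map Gate.toTerm ∧
      Y = E.lhs.encode ++ (E.rhs.encode ++ [.fin]) := by
  rw [E.encode_eq] at h
  obtain ⟨l₁, pre', rfl, h₁⟩ := transduce_eq_inputRecords h
  obtain ⟨hY, gs, hgs, rfl⟩ := transduce_eq_defRecords h₁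
  exact ⟨⟨E.vars, gs⟩, (Circuit.encode_eq ⟨E.vars, gs⟩).symm, rfl, hgs, hY⟩

end Parse

/-! ### Translating a circuit -/

section Translate

variable {k : ℕ}

theorem transduce_zero_numeral (n : ℕ) : ∀ pre l, transduce k 0 pre (numeral n ++ l) =
    numeral n ++ transduce k 0 ((numeral n).reverse ++ pre) l := by
  unfold numeral
  induction n.bits with
  | nil => intro pre l; rfl
  | cons b w ih =>
    intro pre l
    cases b <;>
      simpa [bitSym, transduce, areaBlock, defBlock] using ih _ _

/-- The comma has to look past the first argument. That number is below `n`, hence has at most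
`n.size < k` digits, and the search reaches the gate symbol. -/
theorem transduce_zero_gate (γ : Gate) {n : ℕ} (hγ : γ.RefsBelow n) (hn : n.size < k)
    (pre l : List Letter) : ∃ pre', transduce k 0 pre (γ.encode ++ .fin :: l) =
      .asg :: (γ.toTerm.encode ++ .fin :: transduce k 0 pre' l) := by
  have one : numeral 1 = [.b1] := rfl
  cases γ with
  | and u v =>
    have hu : u.size ≤ n.size := Nat.size_le_size hγ.1.le
    have hs := (scan_numeral u .conj (by decide) pre k).resolve_right (by omega)
    refine ⟨?_, ?_⟩
    rotate_left
    · simp only [Gate.encode, List.cons_append, transduce, areaBlock, defBlock, if_true,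
        List.append_assoc, transduce_zero_numeral, hs, Letter.code]
      simp [Gate.toTerm, ArithTerm.encode]
      rfl
  | or u v =>
    have hu : u.size ≤ n.size := Nat.size_le_size hγ.1.le
    have hs := (scan_numeral u .disj (by decide) pre k).resolve_right (by omega)
    refine ⟨?_, ?_⟩
    rotate_left
    · simp only [Gate.encode, List.cons_append, transduce, areaBlock, defBlock, if_true,
        List.append_assoc, transduce_zero_numeral, hs, Letter.code]
      simp [Gate.toTerm, ArithTerm.encode, intSym, one]
      rfl
  | not u =>
    refine ⟨?_, ?_⟩
    rotate_left
    · simp only [Gate.encode, List.cons_append, transduce, areaBlock, defBlock, if_true,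
        transduce_zero_numeral]
      simp [Gate.toTerm, ArithTerm.encode, intSym, one]
      rfl

theorem transduce_zero_gateRecords : ∀ (gs : List Gate) {n N : ℕ} (pre : List Letter),
    (∀ (j : ℕ) (γ : Gate), gs[j]? = some γ → γ.RefsBelow (n + j)) → n + gs.length ≤ N → N.size < k →
    transduce k 0 pre (gateRecords n gs) = defRecords n (gs.map Gate.toTerm) ++ [.eql]
  | [], _, _, _, _, _, _ => by simp [gateRecords, defRecords, transduce, areaBlock, defBlock]
  | γ :: gs, n, N, pre, h, hN, hk => by
    have h₀ : γ.RefsBelow n := h 0 γ rfl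
    have h₁ : ∀ (j : ℕ) (γ' : Gate), gs[j]? = some γ' → γ'.RefsBelow (n + 1 + j) := fun j γ' hj => by
      have := h (j + 1) γ' (by simpa using hj)
      rwa [show n + (j + 1) = n + 1 + j by omega] at this
    simp only [List.length_cons] at hN
    have hn : n.size ≤ N.size := Nat.size_le_size (by omega)
    rw [gateRecords, transduce_zero_numeral]
    obtain ⟨pre', e⟩ := transduce_zero_gate γ h₀ (hn.trans_lt hk)
      ((numeral n).reverse ++ pre) (gateRecords (n + 1) gs)
    rw [e, transduce_zero_gateRecords gs pre' h₁ (by omega) hk]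
    simp [defRecords]

theorem transduce_zero_inputRecords : ∀ (m i : ℕ) (pre l : List Letter), ∃ pre',
    transduce k 0 pre (inputRecords i m ++ l) = inputRecords i m ++ transduce k 0 pre' l
  | 0, _, pre, _ => ⟨pre, rfl⟩
  | m + 1, i, pre, l => by
    obtain ⟨pre', h⟩ := transduce_zero_inputRecords m (i + 1)
      (.fin :: .inp :: ((numeral i).reverse ++ pre)) l
    refine ⟨pre', ?_⟩
    simp [inputRecords, transduce_zero_numeral, transduce, areaBlock, defBlock, h]

theorem Circuit.transduce_zero_encode (C : Circuit)
    (hC : ∀ (j : ℕ) (γ : Gate), C.gates[j]? = some γ → γ.RefsBelow (C.inputs + j))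
    (hk : (C.inputs + C.gates.length).size < k) : transduce k 0 [] C.encode =
      inputRecords 0 C.inputs ++ (defRecords C.inputs (C.gates.map Gate.toTerm) ++ [.eql]) := by
  obtain ⟨pre', h⟩ := transduce_zero_inputRecords (k := k) C.inputs 0 []
    (gateRecords C.inputs C.gates)
  rw [C.encode_eq, h, transduce_zero_gateRecords _ _ hC le_rfl hk]

end Translate

/-! ### The equation part of a translated circuit -/

section Equation

variable {k : ℕ}

/-- Numbered records with the given contents. -/
def records : ℕ → List (List Letter) → List Letter
  | _, [] => []
  | n, b :: bs => numeral n ++ (b ++ .fin :: records (n + 1) bs)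

theorem records_append : ∀ (as bs : List (List Letter)) (n : ℕ),
    records n (as ++ bs) = records n as ++ records (n + as.length) bs
  | [], _, _ => rfl
  | a :: as, bs, n => by
    simp [records, records_append as bs, Nat.add_assoc, Nat.add_comm 1]

theorem gateRecords_eq : ∀ (gs : List Gate) (n : ℕ),
    gateRecords n gs = records n (gs.map Gate.encode)
  | [], _ => rfl
  | γ :: gs, n => by simp [gateRecords, records, gateRecords_eq gs]

theorem inputRecords_eq : ∀ (m i : ℕ), inputRecords i m = records i (List.replicate m [.inp])
  | 0, _ => rfl
  | m + 1, i => by simp [inputRecords, List.replicate_succ, records, inputRecords_eq m]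

/-- The contents of the records of a circuit. -/
def Circuit.bodies (C : Circuit) : List (List Letter) :=
  List.replicate C.inputs [.inp] ++ C.gates.map Gate.encode

theorem Circuit.encode_eq_records (C : Circuit) : C.encode = records 0 C.bodies := by
  rw [C.encode_eq, gateRecords_eq, inputRecords_eq, bodies, records_append]
  simp

theorem Circuit.length_bodies (C : Circuit) : C.bodies.length = C.inputs + C.gates.length := by
  simp [bodies]

/-- The later node references of a chain term. -/
def chainRefs : ℕ → ℕ → List Letter
  | _, 0 => []
  | i, m + 1 => .pos :: .ref :: (numeral i ++ chainRefs (i + 1) m)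

theorem chainRefs_succ : ∀ m i, chainRefs i (m + 1) =
    chainRefs i m ++ .pos :: .ref :: numeral (i + m)
  | 0, i => by simp [chainRefs]
  | m + 1, i => by
    rw [chainRefs, chainRefs_succ m, chainRefs]
    simp [Nat.add_assoc, Nat.add_comm 1]

/-- Prefix notation separates the chain term into a block of operators and a list of operands, which
is why two passes over the circuit suffice. A lone `pos` in `chainRefs` is the literal 0, whose
numeral is empty. -/
theorem encode_chainTerm (m : ℕ) : (chainTerm m).encode =
    (List.replicate m [Letter.plus, .times]).flatten ++ .ref :: chainRefs 1 m := by
  induction m with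
  | zero => rfl
  | succ m ih =>
    have : (ArithTerm.lit 0).encode = [.pos] := rfl
    rw [chainRefs_succ, List.replicate_succ, chainTerm, ArithTerm.encode, ArithTerm.encode,
      ArithTerm.encode, this, ih]
    simp [Nat.add_comm]

theorem isSome_head?_records (n : ℕ) (bs : List (List Letter)) :
    (records n bs).head?.isSome = !bs.isEmpty := by
  cases bs with
  | nil => rfl
  | cons b bs => simp [records]

theorem fin_notMem_numeral (n : ℕ) : Letter.fin ∉ numeral n := by
  simp only [numeral, List.mem_map, not_exists, not_and]
  rintro (_ | _) - <;> decide

theorem transduce_one_append : ∀ (b pre l : List Letter), Letter.fin ∉ b →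
    transduce k 1 pre (b ++ l) = transduce k 1 (b.reverse ++ pre) l
  | [], _, _, _ => rfl
  | a :: b, pre, l, h => by
    simp only [List.mem_cons, not_or] at h
    have e : ∀ o, opBlock o (some a) = [] := by
      intro o
      cases a <;> first | rfl | exact absurd rfl h.1
    simp [transduce, areaBlock, e, transduce_one_append b _ l h.2]

theorem transduce_one_records : ∀ (bs : List (List Letter)) (n : ℕ) (pre : List Letter),
    (∀ b ∈ bs, Letter.fin ∉ b) → transduce k 1 pre (records n bs) =
      (List.replicate (bs.length - 1) [Letter.plus, .times]).flatten ++ [.ref]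
  | [], _, _, _ => by simp [records, transduce, areaBlock, opBlock]
  | b :: bs, n, pre, h => by
    rw [records, transduce_one_append _ _ _ (fin_notMem_numeral n),
      transduce_one_append _ _ _ (h b (by simp)), transduce,
      transduce_one_records bs _ _ fun b hb => h b (by simp [hb])]
    cases bs with
    | nil => simp [records, areaBlock, opBlock]
    | cons b' bs => simp [isSome_head?_records, areaBlock, opBlock, List.replicate_succ]

/-- Digits of gate arguments are dropped in the third pass: their search finds `a` or gives up on a
digit, but never finds the start of the string or the end of a record. No bound on `k` is needed. -/
theorem transduce_two_digits (a : Letter) (ha : 2 < a.code) (ha' : a.code ≠ 8) (l : List Letter)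
    (pre : List Letter) : ∀ w w' : List Bool,
    transduce k 2 (w'.map bitSym ++ a :: pre) (w.map bitSym ++ l) =
      transduce k 2 ((w.map bitSym).reverse ++ (w'.map bitSym ++ a :: pre)) l
  | [], _ => rfl
  | b :: w, w' => by
    have hs := scan_digits w' a ha pre (s := 1) (k := k) (by decide)
    have e : ∀ o, refBlock (scan 1 k (w'.map bitSym ++ a :: pre)) o (some (bitSym b)) = [] := by
      intro o
      have h₀ : scan 1 k (w'.map bitSym ++ a :: pre) ≠ 0 := by omega
      have h₈ : scan 1 k (w'.map bitSym ++ a :: pre) ≠ 8 := by omega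
      cases b <;> simp [refBlock, bitSym, h₀, h₈]
    have ih := transduce_two_digits a ha ha' l pre w (b :: w')
    simp only [List.map_cons, List.cons_append] at ih
    simp [transduce, areaBlock, e, ih]

theorem transduce_two_gate (γ : Gate) (pre l : List Letter) :
    transduce k 2 pre (γ.encode ++ l) = transduce k 2 (γ.encode.reverse ++ pre) l := by
  have key : ∀ (a : Letter), 2 < a.code → a.code ≠ 8 → ∀ n pre l,
      transduce k 2 pre (a :: (numeral n ++ l)) =
        transduce k 2 ((numeral n).reverse ++ a :: pre) l := by
    intro a ha ha' n pre l
    have e : ∀ s o, refBlock s o (some a) = [] := by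
      intro s o
      cases a <;> first | rfl | simp [Letter.code] at ha ha'
    have := transduce_two_digits (k := k) a ha ha' l pre n.bits []
    simp only [transduce, areaBlock, e]
    simpa [numeral] using this
  cases γ with
  | and u v | or u v =>
    simp only [Gate.encode, List.cons_append, List.append_assoc]
    rw [key _ (by decide) (by decide), key _ (by decide) (by decide)]
    simp
  | not u =>
    simp only [Gate.encode, List.cons_append]
    rw [key _ (by decide) (by decide)]
    simp

/-- The digits of a record number are kept, because they follow the start of the string or the end
of the previous record. Here the search must succeed, hence the bound by `k`. -/
theorem transduce_two_number {pre : List Letter} (hpre : pre = [] ∨ ∃ z, pre = .fin :: z)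
    (l : List Letter) : ∀ w w' : List Bool, w.length + w'.length < k →
    transduce k 2 (w'.map bitSym ++ pre) (w.map bitSym ++ l) =
      w.map bitSym ++ transduce k 2 ((w.map bitSym).reverse ++ (w'.map bitSym ++ pre)) l
  | [], _, _ => rfl
  | b :: w, w', hk => by
    simp only [List.length_cons] at hk
    have hs : scan 1 k (w'.map bitSym ++ pre) = 0 ∨ scan 1 k (w'.map bitSym ++ pre) = 8 := by
      obtain rfl | ⟨z, rfl⟩ := hpre
      · left; simpa using scan_digits_nil w' (by omega)
      · exact .inr ((scan_digits w' .fin (by decide) z (by decide)).resolve_right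
          (by omega))
    have e : ∀ o, refBlock (scan 1 k (w'.map bitSym ++ pre)) o (some (bitSym b)) =
        [bitSym b] := by
      intro o
      cases b <;> simp [refBlock, bitSym, hs]
    have ih := transduce_two_number hpre l w (b :: w') (by simp; omega)
    simp only [List.map_cons, List.cons_append] at ih
    simp [transduce, areaBlock, e, ih]

theorem transduce_two_records : ∀ (bs : List (List Letter)) (n : ℕ) (pre : List Letter),
    (∀ b ∈ bs, ∀ pre l, transduce k 2 pre (b ++ l) = transduce k 2 (b.reverse ++ pre) l) →
    (pre = [] ∨ ∃ z, pre = .fin :: z) → (n + bs.length).size < k →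
    transduce k 2 pre (records n bs) = (if bs = [] then [] else
      numeral n ++ chainRefs (n + 1) (bs.length - 1)) ++ [.pos, .b1, .fin]
  | [], _, _, _, _, _ => by simp [records, transduce, areaBlock, refBlock]
  | b :: bs, n, pre, h, hpre, hk => by
    have hn : n.size ≤ (n + (b :: bs).length).size := Nat.size_le_size (by omega)
    have e := transduce_two_number (k := k) hpre (b ++ .fin :: records (n + 1) bs) n.bits []
      (by rw [Nat.size_eq_bits_len]; simp; omega)
    simp only [List.map_nil, List.nil_append] at e
    rw [records, numeral, e, h b (by simp), transduce,
      transduce_two_records bs _ _ (fun b hb => h b (by simp [hb])) (.inr ⟨_, rfl⟩)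
        (by rwa [List.length_cons, Nat.add_comm _ 1, ← Nat.add_assoc] at hk)]
    cases bs with
    | nil => simp [records, areaBlock, refBlock, chainRefs]
    | cons b' bs => simp [isSome_head?_records, areaBlock, refBlock, numeral, chainRefs]

/-- The second pass ends with `ref`, whose number is the first one copied by the third pass. For a
circuit without nodes nothing is copied, which is the empty numeral of node `0`, so well-formedness
is not required. -/
theorem Circuit.transduce_one_two_encode (C : Circuit)
    (hk : (C.inputs + C.gates.length).size < k) :
    transduce k 1 [] C.encode ++ transduce k 2 [] C.encode =
      C.toEquation.lhs.encode ++ (C.toEquation.rhs.encode ++ [.fin]) := by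
  have one : (ArithTerm.lit 1).encode = [.pos, .b1] := rfl
  rw [C.encode_eq_records, transduce_one_records, transduce_two_records _ _ _ _ (.inl rfl),
    toEquation, encode_chainTerm, one, C.length_bodies]
  · by_cases h : C.bodies = []
    · have := C.length_bodies
      rw [h] at this
      simp [h, ← this, chainRefs]
    · simp [h]
      rfl
  · rwa [Nat.zero_add, C.length_bodies]
  · intro b hb pre l
    simp only [bodies, List.mem_append, List.mem_replicate, List.mem_map] at hb
    obtain ⟨-, rfl⟩ | ⟨γ, -, rfl⟩ := hb
    · simp [transduce, areaBlock, refBlock]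
    · exact transduce_two_gate γ pre l
  · intro b hb
    simp only [bodies, List.mem_append, List.mem_replicate, List.mem_map] at hb
    obtain ⟨-, rfl⟩ | ⟨γ, -, rfl⟩ := hb
    · simp
    · cases γ <;> simp [Gate.encode, fin_notMem_numeral]

/-- The translation of a circuit is the equation. -/
theorem Circuit.transduce_encode (C : Circuit)
    (hC : ∀ (j : ℕ) (γ : Gate), C.gates[j]? = some γ → γ.RefsBelow (C.inputs + j))
    (hk : (C.inputs + C.gates.length).size < k) :
    transduce k 0 [] C.encode ++ (transduce k 1 [] C.encode ++ transduce k 2 [] C.encode) =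
      C.toEquation.encode := by
  rw [C.transduce_one_two_encode hk, C.transduce_zero_encode hC hk, AlgEquation.encode_eq]
  simp [toEquation]

theorem length_le_records : ∀ (bs : List (List Letter)) (n : ℕ), bs.length ≤ (records n bs).length
  | [], _ => le_rfl
  | b :: bs, n => by
    have := length_le_records bs (n + 1)
    simp [records]; omega

/-- A string that is translated to an equation is a circuit, translated to this equation. -/
theorem exists_circuit_of_transduce {D : List Letter} {E : AlgEquation} (hE : E.WellFormed)
    (hk : D.length.size < k)
    (h : transduce k 0 [] D ++ (transduce k 1 [] D ++ transduce k 2 [] D) = E.encode) :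
    ∃ C : Circuit, C.WellFormed ∧ D = C.encode ∧ E = C.toEquation := by
  obtain ⟨C, rfl, hi, hd, hY⟩ := transduce_eq_encode_equation h
  have hN : C.inputs + C.gates.length ≤ C.encode.length := by
    rw [C.encode_eq_records, ← C.length_bodies]
    exact length_le_records _ _
  rw [C.transduce_one_two_encode ((Nat.size_le_size hN).trans_lt hk)] at hY
  have hfin : NoDigitHead [.fin] := noDigitHead_cons (by rintro (_ | _) <;> decide)
  -- Once the node list has revealed the circuit, the other two passes are known, and unique
  -- readability forces both sides of `E`.
  obtain ⟨h₁, h₂⟩ := ArithTerm.encode_append_inj (ArithTerm.noDigitHead_encode _ _)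
    (ArithTerm.noDigitHead_encode _ _) hY
  obtain ⟨h₃, -⟩ := ArithTerm.encode_append_inj hfin hfin h₂
  have hE' : E = C.toEquation := by
    cases E
    simp only at hi hd h₁ h₃
    simp [Circuit.toEquation, hi, hd, ← h₁, ← h₃]
  exact ⟨C, C.wellFormed_toEquation.1 (hE' ▸ hE), rfl, hE'⟩

end Equation

/-! ## The translation of data parts -/

/-- Blocks are filled up with blanks to the length `9`. -/
def padBlock (b : List Letter) : List Letter := b ++ List.replicate (9 - b.length) .blank

/-- How many digits the translation may pass in search of a non-digit. -/
def searchBound (n : ℕ) : ℕ := (2 * n + 1).size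

/-- The block with number `p` of the translation. -/
def numberedBlock (D : List Letter) (p : ℕ) : List Letter :=
  areaBlock (p / (D.length + 1))
    (scan 1 (searchBound D.length) (D.take (p % (D.length + 1))).reverse)
    D[p % (D.length + 1)]? D[p % (D.length + 1) + 1]?

/-- The translation of circuits into equations. -/
def reduction (D : List Letter) : List Letter :=
  (List.range (3 * (D.length + 1))).flatMap fun p => padBlock (numberedBlock D p)

theorem size_lt_searchBound (n : ℕ) : n.size < searchBound n := by
  have h := Nat.size_bit (b := true) (n := n) (by simp [Nat.bit])
  simp only [Nat.bit, cond_true] at h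
  unfold searchBound
  omega

theorem length_areaBlock_le (r s : ℕ) (o next : Option Letter) :
    (areaBlock r s o next).length ≤ 9 := by
  unfold areaBlock
  rcases o with _ | a
  · split_ifs <;> simp [defBlock, opBlock, refBlock]
  · cases a <;> split_ifs <;> simp [defBlock, opBlock, refBlock] <;> split_ifs <;> simp

theorem blank_notMem_areaBlock (r s : ℕ) (o next : Option Letter) :
    Letter.blank ∉ areaBlock r s o next := by
  unfold areaBlock
  rcases o with _ | a
  · split_ifs <;> simp [defBlock, opBlock, refBlock]
  · cases a <;> split_ifs <;> simp [defBlock, opBlock, refBlock] <;> split_ifs <;> simp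

theorem length_padBlock {b : List Letter} (h : b.length ≤ 9) : (padBlock b).length = 9 := by
  simp [padBlock]; omega

theorem eraseBlanks_eq_self {b : List Letter} (h : Letter.blank ∉ b) : eraseBlanks b = b := by
  refine List.filter_eq_self.2 fun a ha => ?_
  simp only [ne_eq, decide_not, Bool.not_eq_eq_eq_not, Bool.not_true, decide_eq_false_iff_not]
  rintro rfl
  exact h ha

theorem eraseBlanks_padBlock {b : List Letter} (h : Letter.blank ∉ b) :
    eraseBlanks (padBlock b) = b := by
  have := eraseBlanks_eq_self h
  unfold eraseBlanks at this
  rw [eraseBlanks, padBlock, List.filter_append, this]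
  simp

theorem eraseBlanks_flatMap {ι : Type*} (l : List ι) (f : ι → List Letter) :
    eraseBlanks (l.flatMap f) = l.flatMap fun i => eraseBlanks (f i) := by
  induction l with
  | nil => rfl
  | cons a l ih =>
    simp only [List.flatMap_cons, ← ih]
    simp [eraseBlanks]

theorem length_reduction (D : List Letter) : (reduction D).length = 27 * (D.length + 1) := by
  unfold reduction
  have h : ∀ p, (padBlock (numberedBlock D p)).length = 9 := fun p =>
    length_padBlock (length_areaBlock_le _ _ _ _)
  simp only [List.length_flatMap, h]
  simp
  ring

/-- The recursive form suits parsing; this form, with one independent block for each position, is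
the one that processors can evaluate. -/
theorem transduce_eq_flatMap (k r : ℕ) : ∀ (l pre : List Letter), transduce k r pre l =
    (List.range (l.length + 1)).flatMap fun i =>
      areaBlock r (scan 1 k ((l.take i).reverse ++ pre)) l[i]? l[i + 1]?
  | [], pre => by simp [transduce]
  | a :: l, pre => by
    rw [transduce, transduce_eq_flatMap k r l, List.length_cons, List.range_succ_eq_map (n := l.length + 1),
      List.flatMap_cons, List.flatMap_map]
    simp [List.head?_eq_getElem?]

theorem eraseBlanks_reduction (D : List Letter) : eraseBlanks (reduction D) =
    transduce (searchBound D.length) 0 [] D ++ (transduce (searchBound D.length) 1 [] D ++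
      transduce (searchBound D.length) 2 [] D) := by
  have area : ∀ r, (List.range (D.length + 1)).flatMap
      (fun i => numberedBlock D (r * (D.length + 1) + i)) =
        transduce (searchBound D.length) r [] D := by
    intro r
    rw [transduce_eq_flatMap]
    refine List.flatMap_congr fun i hi => ?_
    have hi : i < D.length + 1 := List.mem_range.1 hi
    rw [numberedBlock, Nat.mul_comm, Nat.mul_add_div (Nat.succ_pos _), Nat.div_eq_of_lt hi,
      Nat.mul_add_mod, Nat.mod_eq_of_lt hi]
    simp
  have h3 : ∀ N, 3 * N = N + (N + N) := fun N => by ring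
  rw [reduction, eraseBlanks_flatMap]
  simp only [fun p => eraseBlanks_padBlock (b := numberedBlock D p)
    (blank_notMem_areaBlock _ _ _ _)]
  rw [← area 0, ← area 1, ← area 2]
  generalize D.length + 1 = N
  rw [h3, List.range_add, List.range_add]
  simp [List.flatMap_map, two_mul, Nat.add_assoc]

/-! ## The translation of problem parts -/

/-- The translation of a truth value into an integer, with a comma for other symbols. -/
def valueSym : Letter → List Letter
  | .b0 => [.pos]
  | .b1 => [.pos, .b1]
  | _ => [.comma]

/-- The translation of the first `m` truth values. -/
def translateInputs (m : ℕ) (P : List Letter) : List Letter := (P.take m).flatMap valueSym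

theorem eraseBlanks_translateInputs (m : ℕ) (P : List Letter) :
    eraseBlanks (translateInputs m P) = translateInputs m P := by
  rw [translateInputs, eraseBlanks_flatMap]
  refine List.flatMap_congr fun a _ => ?_
  cases a <;> rfl

theorem flatMap_valueSym_bits (x : List Bool) :
    (x.map bitSym).flatMap valueSym = (x.map boolInt).flatMap intSym := by
  rw [List.flatMap_map, List.flatMap_map]
  refine List.flatMap_congr fun b _ => ?_
  cases b <;> rfl

theorem exists_bits_of_comma_notMem : ∀ {P : List Letter}, Letter.comma ∉ P.flatMap valueSym →
    ∃ x : List Bool, P = x.map bitSym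
  | [], _ => ⟨[], rfl⟩
  | a :: P, h => by
    simp only [List.flatMap_cons, List.mem_append, not_or] at h
    obtain ⟨x, rfl⟩ := exists_bits_of_comma_notMem h.2
    cases a with
    | b0 => exact ⟨false :: x, rfl⟩
    | b1 => exact ⟨true :: x, rfl⟩
    | _ => simp [valueSym] at h

theorem comma_notMem_intSym (c : ℤ) : Letter.comma ∉ intSym c := by
  have : ∀ n, Letter.comma ∉ numeral n := by
    intro n
    simp only [numeral, List.mem_map, not_exists, not_and]
    rintro (_ | _) - <;> decide
  cases c <;> simp [intSym, this]

/-- The translation is correct if more truth values are translated than there are inputs. -/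
theorem cvp_iff_aerp (m : ℕ) (D P : List Letter)
    (hm : ∀ C : Circuit, D = C.encode → C.inputs < m) :
    CVP D P ↔ AERP (reduction D) (translateInputs m P) := by
  have hk := size_lt_searchBound D.length
  constructor
  · rintro ⟨C, x, hC, hx, rfl, rfl, ha⟩
    have hN : C.inputs + C.gates.length ≤ C.encode.length := by
      rw [C.encode_eq_records, ← C.length_bodies]
      exact length_le_records _ _
    refine ⟨C.toEquation, x.map boolInt, C.wellFormed_toEquation.2 hC, by simp [hx, Circuit.toEquation],
      ?_, ?_, (C.isRoot_toEquation hC x hx).2 ha⟩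
    · rw [eraseBlanks_reduction, C.transduce_encode hC.2 ((Nat.size_le_size hN).trans_lt hk)]
    -- The problem part has `C.inputs < m` symbols, so nothing is cut off.
    · have := hm C rfl
      rw [eraseBlanks_translateInputs, translateInputs, List.take_of_length_le (by simp; omega),
        flatMap_valueSym_bits]
  · rintro ⟨E, A, hE, hA, hD, hP, hr⟩
    rw [eraseBlanks_reduction] at hD
    obtain ⟨C, hC, rfl, rfl⟩ := exists_circuit_of_transduce hE hk hD
    have hlt := hm C rfl
    rw [eraseBlanks_translateInputs, translateInputs] at hP
    -- A symbol other than a bit would have left a comma, which no list of integers contains.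
    obtain ⟨x, hx⟩ := exists_bits_of_comma_notMem (P := P.take m) (by
      rw [hP, List.mem_flatMap]
      rintro ⟨c, -, hc⟩
      exact comma_notMem_intSym c hc)
    rw [hx, flatMap_valueSym_bits] at hP
    obtain rfl := flatMap_intSym_injective hP
    have hl : x.length = C.inputs := by simpa [Circuit.toEquation] using hA
    -- The truncated string has only `C.inputs < m` symbols, so it was not truncated at all.
    have hPm : P.length ≤ m := by
      have := congrArg List.length hx
      simp at this
      omega
    rw [List.take_of_length_le hPm] at hx
    exact ⟨C, x, hC, hl, rfl, hx, (C.isRoot_toEquation hC x hl).1 hr⟩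

/-! ## A sublinear bound on the number of inputs -/

/-- The number of rounds in which a string of length `n` is used up, if the round `i` uses up
`1 + i.size` symbols, starting with the round `i`. -/
def rounds (i : ℕ) : ℕ → ℕ
  | 0 => 0
  | n + 1 => rounds (i + 1) (n - i.size) + 1
termination_by n => n

theorem rounds_zero (i : ℕ) : rounds i 0 = 0 := by rw [rounds]

theorem rounds_succ (i n : ℕ) : rounds i (n + 1) = rounds (i + 1) (n - i.size) + 1 := by
  rw [rounds]

theorem length_numeral (n : ℕ) : (numeral n).length = n.size := by
  rw [numeral, List.length_map, Nat.size_eq_bits_len]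

/-- The record of input `i` has `i.size + 2` symbols, more than the round `i` uses up. -/
theorem lt_rounds : ∀ (m i n : ℕ), (inputRecords i m).length < n → m < rounds i n
  | m, i, 0, h => by simp at h
  | 0, i, n + 1, _ => by rw [rounds_succ]; omega
  | m + 1, i, n + 1, h => by
    simp only [inputRecords, List.length_append, List.length_cons, length_numeral] at h
    have := lt_rounds m (i + 1) (n - i.size) (by omega)
    rw [rounds_succ]
    omega

/-- At most `2 ^ K - i` rounds have a number below `2 ^ K`. Every later one uses up more than `K +
1` symbols, except possibly an incomplete last round, which the summand `K + 1` pays for. -/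
theorem rounds_mul_le (K n : ℕ) : ∀ i, rounds i n * (K + 1) ≤
    n + (K + 1) + (2 ^ K - i) * (K + 1) := by
  induction n using Nat.strong_induction_on with
  | _ n ih =>
    intro i
    cases n with
    | zero => simp [rounds_zero]
    | succ n =>
      rw [rounds_succ, Nat.add_mul]
      have := ih (n - i.size) (by omega) (i + 1)
      by_cases hi : i < 2 ^ K
      · have e : 2 ^ K - i = (2 ^ K - (i + 1)) + 1 := by omega
        rw [e, Nat.add_mul]
        omega
      · have hs : K < i.size := Nat.lt_size.2 (by omega)
        have e : 2 ^ K - i = 0 := by omega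
        have e' : 2 ^ K - (i + 1) = 0 := by omega
        rw [e'] at this
        rw [e]
        by_cases hn : i.size ≤ n
        · omega
        · have : n - i.size = 0 := by omega
          rw [this, rounds_zero]
          omega

theorem isLittleO_rounds :
    (fun n : ℕ => (rounds 0 n : ℝ)) =o[atTop] fun n : ℕ => (n : ℝ) := by
  rw [isLittleO_iff]
  intro c hc
  -- With this `K`, the late rounds number at most `(c / 2) * n`; the threshold for `n` lets the
  -- other `2 ^ K + 1` rounds fit into the other half.
  obtain ⟨K, hK⟩ := exists_nat_gt (2 / c)
  filter_upwards [eventually_ge_atTop ⌈2 * (2 ^ K + 1) / c⌉₊] with n hn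
  have hn : 2 * (2 ^ K + 1) / c ≤ (n : ℝ) := (Nat.le_ceil _).trans (by exact_mod_cast hn)
  rw [div_le_iff₀ hc] at hn
  rw [div_lt_iff₀ hc] at hK
  have h : (rounds 0 n : ℝ) * (K + 1) ≤ n + (K + 1) + 2 ^ K * (K + 1) := by
    exact_mod_cast rounds_mul_le K n 0
  rw [Real.norm_natCast, Real.norm_natCast]
  have hK0 : (0 : ℝ) < K + 1 := by positivity
  refine le_of_mul_le_mul_right ?_ hK0
  have h1 : (2 : ℝ) * n ≤ (c * n) * (K + 1) := by
    have : (0 : ℝ) ≤ n := by positivity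
    nlinarith
  have h2 : (2 : ℝ) * ((2 ^ K + 1) * (K + 1)) ≤ (c * n) * (K + 1) := by
    nlinarith
  linarith

/-! ## The preprocessing in polynomial time -/

/-- Addition of a carry bit to a binary number. -/
def addCarry : Bool → List Bool → List Bool
  | c, [] => if c then [true] else []
  | c, b :: w => xor b c :: addCarry (b && c) w

theorem addCarry_false : ∀ w, addCarry false w = w
  | [] => rfl
  | b :: w => by simp [addCarry, addCarry_false w]

theorem addCarry_true (n : ℕ) : addCarry true n.bits = (n + 1).bits := by
  induction n using Nat.strong_induction_on with
  | _ n ih =>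
    obtain ⟨m, rfl | rfl⟩ := Nat.even_or_odd' n
    · rcases m.eq_zero_or_pos with rfl | hm
      · simp [addCarry]
      · rw [Nat.bit0_bits m hm.ne', Nat.bit1_bits]
        simp [addCarry, addCarry_false]
    · rw [Nat.bit1_bits, show 2 * m + 1 + 1 = 2 * (m + 1) by ring, Nat.bit0_bits _ (by omega)]
      simp [addCarry, ih m (by omega)]

namespace RoundCounter

open Turing

/-- The stacks: input, output, the counter, and the counter reversed. -/
inductive Stack | input | output | counter | reversed
  deriving DecidableEq

instance : Fintype Stack where
  elems := {.input, .output, .counter, .reversed}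
  complete x := by cases x <;> decide

/-- The labels of the program. -/
inductive Label | start | increment | restore | clear
  deriving DecidableEq

instance : Fintype Label where
  elems := {.start, .increment, .restore, .clear}
  complete x := by cases x <;> decide

/-- The program; its variables are the last symbol removed from a stack, and a carry. -/
def program : Label → TM2.Stmt (fun _ : Stack => Letter) Label (Option Letter × Bool)
  | .start => .pop .input (fun _ o => (o, true)) <|
      .branch (fun v => v.1.isNone) (.goto fun _ => .clear) <|
      .push .output (fun _ => .fin) <| .goto fun _ => .increment
  | .increment => .pop .counter (fun v o => (o, v.2)) <|
      .branch (fun v => v.1.isNone)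
        (.branch (fun v => v.2) (.push .reversed (fun _ => .b1) <| .goto fun _ => .restore)
          (.goto fun _ => .restore)) <|
      -- Each digit of the counter is charged one input symbol, which is discarded. With the symbol
      -- removed at `start`, the round `i` uses up `1 + i.size` symbols.
      .pop .input (fun v _ => v) <|
      .push .reversed (fun v => bitSym (xor (decide (v.1 = some .b1)) v.2)) <|
      .load (fun v => (none, decide (v.1 = some .b1) && v.2)) <| .goto fun _ => .increment
  | .restore => .pop .reversed (fun v o => (o, v.2)) <|
      .branch (fun v => v.1.isNone) (.goto fun _ => .start) <|
      .push .counter (fun v => v.1.getD .b0) <| .goto fun _ => .restore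
  | .clear => .pop .counter (fun v o => (o, v.2)) <|
      .branch (fun v => v.1.isNone) (.load (fun _ => (none, false)) .halt) <|
      .goto fun _ => .clear

/-- The machine. -/
def machine : FinTM2 where
  K := Stack
  k₀ := .input
  k₁ := .output
  Γ _ := Letter
  Λ := Label
  main := .start
  σ := Option Letter × Bool
  initialState := (none, false)
  Γk₀Fin := inferInstanceAs (Fintype Letter)
  m := program

/-- The contents of the stacks. -/
def stackFun (x y c d : List Letter) : Stack → List Letter
  | .input => x
  | .output => y
  | .counter => c
  | .reversed => d

section

variable (x y c d z : List Letter)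

theorem update_input : Function.update (stackFun x y c d) .input z = stackFun z y c d := by
  funext k; cases k <;> rfl

theorem update_output : Function.update (stackFun x y c d) .output z = stackFun x z c d := by
  funext k; cases k <;> rfl

theorem update_counter : Function.update (stackFun x y c d) .counter z = stackFun x y z d := by
  funext k; cases k <;> rfl

theorem update_reversed : Function.update (stackFun x y c d) .reversed z = stackFun x y c z := by
  funext k; cases k <;> rfl

end

/-- The configurations of the machine. -/
abbrev Cfg : Type := TM2.Cfg (fun _ : Stack => Letter) Label (Option Letter × Bool)

/-- Reachability in a given number of steps. -/
def Reaches (n : ℕ) (a b : Cfg) : Prop :=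
  (flip Bind.bind (TM2.step program))^[n] (some a) = some b

theorem Reaches.trans {m n : ℕ} {a b c : Cfg} (h : Reaches m a b) (h' : Reaches n b c) :
    Reaches (m + n) a c := by
  unfold Reaches at *
  rw [Nat.add_comm, Function.iterate_add_apply, h, h']

theorem Reaches.of_step {a b : Cfg} (h : TM2.step program a = some b) : Reaches 1 a b := h

/-- A running configuration. -/
def cfg (l : Label) (v : Option Letter × Bool) (x y c d : List Letter) : Cfg :=
  ⟨some l, v, stackFun x y c d⟩

theorem reaches_increment : ∀ (w : List Bool) (v : Option Letter) (b : Bool)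
    (x y d : List Letter), ∃ v', Reaches (w.length + 1)
      (cfg .increment (v, b) x y (w.map bitSym) d)
      (cfg .restore v' (x.drop w.length) y [] (((addCarry b w).map bitSym).reverse ++ d))
  | [], v, b, x, y, d => ⟨(none, b), by
    apply Reaches.of_step
    cases b <;> simp [cfg, program, addCarry, stackFun, update_counter, update_reversed,
      bitSym]⟩
  | a :: w, v, b, x, y, d => by
    obtain ⟨v', h⟩ := reaches_increment w none (a && b) x.tail y (bitSym (xor a b) :: d)
    refine ⟨v', ?_⟩
    have e : Reaches 1 (cfg .increment (v, b) x y ((a :: w).map bitSym) d)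
        (cfg .increment (none, a && b) x.tail y (w.map bitSym) (bitSym (xor a b) :: d)) := by
      apply Reaches.of_step
      cases a <;> cases b <;> simp [cfg, program, stackFun, update_counter,
        update_reversed, update_input, bitSym]
    have := e.trans h
    rw [List.length_cons, Nat.add_comm (w.length + 1) 1]
    simpa [addCarry] using this

theorem reaches_restore : ∀ (d c x y : List Letter) (v : Option Letter × Bool), ∃ v',
    Reaches (d.length + 1) (cfg .restore v x y c d) (cfg .start v' x y (d.reverse ++ c) [])
  | [], c, x, y, v => ⟨(none, v.2), by
    apply Reaches.of_step
    simp [cfg, program, stackFun, update_reversed]⟩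
  | a :: d, c, x, y, v => by
    obtain ⟨v', h⟩ := reaches_restore d (a :: c) x y (some a, v.2)
    refine ⟨v', ?_⟩
    have e : Reaches 1 (cfg .restore v x y c (a :: d))
        (cfg .restore (some a, v.2) x y (a :: c) d) := by
      apply Reaches.of_step
      simp [cfg, program, stackFun, update_reversed, update_counter]
    have := e.trans h
    rw [List.length_cons, Nat.add_comm (d.length + 1) 1]
    simpa using this

/-- The halting configuration in the definition of computability has all stacks but the output empty
and the variables at their initial values. -/
theorem reaches_clear : ∀ (c y : List Letter) (v : Option Letter × Bool),
    Reaches (c.length + 1) (cfg .clear v [] y c []) ⟨none, (none, false), stackFun [] y [] []⟩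
  | [], y, v => by
    apply Reaches.of_step
    simp [cfg, program, stackFun, update_counter]
  | a :: c, y, v => by
    have e : Reaches 1 (cfg .clear v [] y (a :: c) []) (cfg .clear (some a, v.2) [] y c []) := by
      apply Reaches.of_step
      simp [cfg, program, stackFun, update_counter]
    have := e.trans (reaches_clear c y (some a, v.2))
    rwa [List.length_cons, Nat.add_comm (c.length + 1) 1]

theorem reaches_round (i : ℕ) (a : Letter) (x y : List Letter) (v : Option Letter × Bool) :
    ∃ v', Reaches (1 + (i.size + 1) + ((i + 1).size + 1)) (cfg .start v (a :: x) y (numeral i) [])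
      (cfg .start v' (x.drop i.size) (.fin :: y) (numeral (i + 1)) []) := by
  obtain ⟨v₁, h₁⟩ := reaches_increment i.bits (some a) true x (.fin :: y) []
  rw [addCarry_true, Nat.size_eq_bits_len] at h₁
  obtain ⟨v₂, h₂⟩ := reaches_restore (((i + 1).bits.map bitSym).reverse ++ []) []
    (x.drop i.size) (.fin :: y) v₁
  have h₀ : Reaches 1 (cfg .start v (a :: x) y (numeral i) [])
      (cfg .increment (some a, true) x (.fin :: y) (i.bits.map bitSym) []) := by
    apply Reaches.of_step
    simp [cfg, program, stackFun, update_input, update_output, numeral]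
  have := (h₀.trans h₁).trans h₂
  exact ⟨v₂, by simpa [numeral, Nat.size_eq_bits_len] using this⟩

/-- Each round removes an input symbol, so there are at most `n` rounds and the counter never
exceeds `i + n`. The crude estimate `j.size ≤ j` then bounds each round by `2 * (i + n) + 5` steps,
and the rest pays for clearing the counter. -/
theorem reaches_halt (n : ℕ) : ∀ (i : ℕ) (x y : List Letter) (v : Option Letter × Bool),
    x.length = n → ∃ s ≤ n * (2 * (i + n) + 5) + (i + n) + 2,
      Reaches s (cfg .start v x y (numeral i) [])
        ⟨none, (none, false), stackFun [] (List.replicate (rounds i n) .fin ++ y) [] []⟩ := by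
  induction n using Nat.strong_induction_on with
  | _ n ih =>
    intro i x y v hx
    have size_le : ∀ j : ℕ, j.size ≤ j := fun j => Nat.size_le.2 j.lt_two_pow_self
    cases n with
    | zero =>
      obtain rfl := List.length_eq_zero_iff.1 hx
      have h₀ : Reaches 1 (cfg .start v [] y (numeral i) [])
          (cfg .clear (none, true) [] y (numeral i) []) := by
        apply Reaches.of_step
        simp [cfg, program, stackFun, update_input]
      refine ⟨_, ?_, by simpa [rounds_zero] using h₀.trans (reaches_clear (numeral i) y _)⟩
      rw [length_numeral]
      have := size_le i
      omega
    | succ n =>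
      cases x with
      | nil => simp at hx
      | cons a x =>
        have hx : x.length = n := by simpa using hx
        obtain ⟨v', h₁⟩ := reaches_round i a x y v
        obtain ⟨s, hs, h₂⟩ := ih (n - i.size) (by omega) (i + 1) (x.drop i.size) (.fin :: y) v'
          (by simp [hx])
        have h₀ := h₁.trans h₂
        refine ⟨_, ?_, by rwa [rounds_succ, List.replicate_succ', List.append_assoc]⟩
        · have h₃ := size_le i
          have h₄ := size_le (i + 1)
          have h₅ : (n - i.size) * (2 * (i + 1 + (n - i.size)) + 5) ≤ n * (2 * (i + (n + 1)) + 5) :=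
            Nat.mul_le_mul (by omega) (by omega)
          rw [Nat.add_mul n]
          omega

end RoundCounter

open RoundCounter Turing in
theorem pTimeComputable_replicate_rounds :
    PTimeComputable fun x => List.replicate (rounds 0 x.length) .fin := by
  -- The polynomial is the bound of `reaches_halt` for `i = 0`.
  have key : ∀ x : List Letter, ∃ s ≤ (2 * Polynomial.X ^ 2 + 6 * Polynomial.X + 2 :
      Polynomial ℕ).eval x.length, (flip Bind.bind machine.step)^[s]
        (some (Turing.initList machine (x.map (Equiv.refl Letter).invFun))) =
        some (Turing.haltList machine ((List.replicate (rounds 0 x.length) Letter.fin).map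
          (Equiv.refl Letter).invFun)) := by
    intro x
    obtain ⟨s, hs, h⟩ := reaches_halt x.length 0 x [] (none, false) rfl
    refine ⟨s, hs.trans ?_, ?_⟩
    · simp only [Polynomial.eval_add, Polynomial.eval_mul, Polynomial.eval_pow, Polynomial.eval_X,
        Polynomial.eval_ofNat]
      ring_nf
      omega
    · have hi : ∀ k, (Turing.initList machine (x.map (Equiv.refl Letter).invFun)).stk k =
          stackFun x [] [] [] k := by
        intro k
        cases k <;> simp [Turing.initList, machine, stackFun]
        rfl
      have hf : ∀ k, (Turing.haltList machine ((List.replicate (rounds 0 x.length)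
          Letter.fin).map (Equiv.refl Letter).invFun)).stk k =
          stackFun [] (List.replicate (rounds 0 x.length) .fin) [] [] k := by
        intro k
        cases k <;> simp [Turing.haltList, machine, stackFun]
        rfl
      have hi' : Turing.initList machine (x.map (Equiv.refl Letter).invFun) =
          cfg .start (none, false) x [] [] [] := congrArg (TM2.Cfg.mk _ _) (funext hi)
      have hf' : Turing.haltList machine ((List.replicate (rounds 0 x.length)
          Letter.fin).map (Equiv.refl Letter).invFun) = (⟨none, (none, false),
          stackFun [] (List.replicate (rounds 0 x.length) .fin) [] []⟩ : Cfg) :=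
        congrArg (TM2.Cfg.mk _ _) (funext hf)
      rw [hi', hf']
      rw [List.append_nil] at h
      exact h
  choose s hs h using key
  exact ⟨{
    tm := machine
    inputAlphabet := Equiv.refl Letter
    outputAlphabet := Equiv.refl Letter
    time := 2 * Polynomial.X ^ 2 + 6 * Polynomial.X + 2
    outputsFun := fun x => { steps := s x, evals_in_steps := h x, steps_le_m := hs x } }⟩

/-! ## The random-access machine -/

namespace InputTranslator

/-- The states: counting the preprocessed string, translating, the second symbol of the integer
`1`; random access is not used. -/
inductive State | count | translate | one | access
  deriving DecidableEq

instance : Fintype State where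
  elems := {.count, .translate, .one, .access}
  complete x := by cases x <;> decide

/-- An action that leaves the index tapes alone. -/
def act (s : State) (m : Move) (w₀ w₁ : Option Letter) (m₀ m₁ : Move) :
    RAction 1 State Letter where
  next := s
  inMove := m
  write i := if i = 0 then w₀ else w₁
  move i := if i = 0 then m₀ else m₁
  ixWrite _ := none
  ixMove _ := .stay

/-- The transition function. -/
def transition : State → Option (Letter ⊕ Unit) → Option Letter → Option (RAction 1 State Letter)
  | .count, some (.inl _), _ => some (act .count .right none (some .fin) .stay .right)
  | .count, some (.inr _), _ => some (act .translate .right none none .stay .left)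
  | .translate, some (.inl .b1), some a =>
    some (act .one .stay (some .pos) (some a) .right .stay)
  | .translate, some (.inl .b0), some _ =>
    some (act .translate .right (some .pos) none .right .left)
  | .translate, some (.inl _), some _ =>
    some (act .translate .right (some .comma) none .right .left)
  | .one, _, _ => some (act .translate .right (some .b1) none .right .left)
  | _, _, _ => none

/-- The machine that translates as many truth values as there are symbols before the separator;
its second work tape is a unary counter. -/
def machine : RATM (Letter ⊕ Unit) Letter where
  k := 1
  State := State
  Work := Letter
  start := .count
  access := .access
  outSym := Function.Embedding.refl Letter
  δ s a w _ := transition s a (w 1)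

/-- A configuration with output `w`, counter `m`, and the head of the counter on cell `p`. -/
def cfg (s : State) (h : ℕ) (w : List Letter) (m p : ℕ) : machine.Config where
  state := s
  inHead := h
  tape := fun i : Fin 2 =>
    if i = 0 then fun j => w[j]? else fun j => if j < m then some .fin else none
  head := fun i : Fin 2 => if i = 0 then w.length else p
  ixTape _ _ := none
  ixHead _ := 0

theorem update_output (w : List Letter) (a : Letter) :
    Function.update (fun j => w[j]?) w.length (some a) = fun j => (w ++ [a])[j]? := by
  funext j
  rcases lt_trichotomy j w.length with h | rfl | h
  · rw [Function.update_of_ne h.ne, List.getElem?_append_left h]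
  · simp
  · rw [Function.update_of_ne h.ne', List.getElem?_eq_none h.le,
      List.getElem?_eq_none (by simp; omega)]

theorem update_output_none (w : List Letter) :
    Function.update (fun j => w[j]?) w.length none = fun j => w[j]? := by
  funext j
  by_cases h : j = w.length
  · subst h; simp
  · rw [Function.update_of_ne h]

theorem update_counter_succ (m : ℕ) :
    Function.update (fun j => if j < m then some Letter.fin else none) m (some .fin) =
      fun j => if j < m + 1 then some .fin else none := by
  funext j
  by_cases h : j = m
  · subst h; simp
  · rw [Function.update_of_ne h]
    exact if_congr (by omega) rfl rfl

theorem update_counter_pred (m : ℕ) :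
    Function.update (fun j => if j < m then some Letter.fin else none) (m - 1) none =
      fun j => if j < m - 1 then some .fin else none := by
  funext j
  by_cases h : j = m - 1
  · subst h; simp
  · rw [Function.update_of_ne h]
    exact if_congr (by omega) rfl rfl

theorem update_counter_same (m : ℕ) (hm : 0 < m) :
    Function.update (fun j => if j < m then some Letter.fin else none) (m - 1) (some .fin) =
      fun j => if j < m then some .fin else none := by
  funext j
  by_cases h : j = m - 1
  · subst h; simp [hm]
  · rw [Function.update_of_ne h]

theorem update_counter_none (m : ℕ) :
    Function.update (fun j => if j < m then some Letter.fin else none) m none =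
      fun j => if j < m then some .fin else none := by
  funext j
  by_cases h : j = m
  · subst h; simp
  · rw [Function.update_of_ne h]

variable {input : List (Letter ⊕ Unit)}

theorem action_cfg (s : State) (h : ℕ) (w : List Letter) (m p : ℕ) :
    machine.action input (cfg s h w m p) =
      transition s input[h]? (if p < m then some .fin else none) := rfl

theorem pair_ext {α : Type*} {f g : Fin 2 → α} (h₀ : f 0 = g 0) (h₁ : f 1 = g 1) : f = g :=
  funext (Fin.forall_fin_two.2 ⟨h₀, h₁⟩)

theorem step_cfg {s s' : State} {h : ℕ} {w w' : List Letter} {m m' p : ℕ} {M M₀ M₁ : Move}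
    {w₀ w₁ : Option Letter} (hs : s' ≠ .access)
    (ht : transition s input[h]? (if p < m then some .fin else none) =
      some (act s' M w₀ w₁ M₀ M₁))
    (h₀ : Function.update (fun j => w[j]?) w.length w₀ = fun j => w'[j]?)
    (h₀' : M₀.apply w.length = w'.length)
    (h₁ : Function.update (fun j => if j < m then some Letter.fin else none) p w₁ =
      fun j => if j < m' then some .fin else none) :
    machine.step input (cfg s h w m p) = cfg s' (M.apply h) w' m' (M₁.apply p) := by
  have e : machine.action input (cfg s h w m p) = some (act s' M w₀ w₁ M₀ M₁) := ht
  rw [RATM.step, e]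
  have hne : (act s' M w₀ w₁ M₀ M₁).next ≠ machine.access := hs
  refine (if_neg hne).trans ?_
  have e₁ : (machine.perform (cfg s h w m p) (act s' M w₀ w₁ M₀ M₁)).tape =
      (cfg s' (M.apply h) w' m' (M₁.apply p)).tape := pair_ext h₀ h₁
  have e₂ : (machine.perform (cfg s h w m p) (act s' M w₀ w₁ M₀ M₁)).head =
      (cfg s' (M.apply h) w' m' (M₁.apply p)).head := pair_ext h₀' rfl
  have e₃ : (machine.perform (cfg s h w m p) (act s' M w₀ w₁ M₀ M₁)).ixTape =
      (cfg s' (M.apply h) w' m' (M₁.apply p)).ixTape :=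
    funext fun _ => Function.update_eq_self 0 _
  exact congr (congr (congrArg (fun t d x => RATM.Config.mk s' (M.apply h) t d x fun _ => 0) e₁) e₂) e₃

theorem iterate_count {x : List Letter} {l : List (Letter ⊕ Unit)} : ∀ n ≤ x.length,
    (machine.step (x.map Sum.inl ++ l))^[n] machine.init = cfg .count n [] n n
  | 0, _ => by
    have : (fun _ : ℕ => (none : Option Letter)) = fun j => ([] : List Letter)[j]? := by
      funext j; simp
    have e₁ : machine.init.tape = (cfg .count 0 [] 0 0).tape := pair_ext this (by
      funext j
      exact (if_neg (c := j < 0) (t := some Letter.fin) (e := none) (Nat.not_lt_zero j)).symm)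
    have e₂ : machine.init.head = (cfg .count 0 [] 0 0).head := pair_ext rfl rfl
    exact congr (congrArg (fun t d => RATM.Config.mk State.count 0 t d (fun _ _ => none)
      (fun _ => 0)) e₁) e₂
  | n + 1, hn => by
    rw [Function.iterate_succ_apply', iterate_count n (by omega)]
    have e : (x.map Sum.inl ++ l : List (Letter ⊕ Unit))[n]? = some (.inl x[n]) := by
      rw [List.getElem?_append_left (by simpa using hn)]
      simp [List.getElem?_eq_getElem (show n < x.length by omega)]
    exact step_cfg (M := .right) (M₀ := .stay) (M₁ := .right) (by decide) (by rw [e]; rfl)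
      (update_output_none []) rfl (update_counter_succ n)

/-- The counter head stands on the last mark, cell `m - 1`. For `m = 0` it stands on the blank cell
`0`, since a left move stays there, and the machine halts. It also halts when `y` is used up, so the
time is at most `2 * m` whatever the length of `y`. -/
theorem iterate_translate (y : List Letter) : ∀ (m h : ℕ) (w : List Letter),
    (∀ i, input[h + i]? = y[i]?.map Sum.inl) →
    ∃ s ≤ 2 * m, ∃ h' m' p', (machine.step input)^[s] (cfg .translate h w m (m - 1)) =
      cfg .translate h' (w ++ translateInputs m y) m' p' ∧
      machine.action input (cfg .translate h' (w ++ translateInputs m y) m' p') = none := by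
  induction y with
  | nil =>
    intro m h w hy
    refine ⟨0, by omega, h, m, m - 1, by simp [translateInputs], ?_⟩
    have := hy 0
    simp only [Nat.add_zero, List.getElem?_nil, Option.map_none] at this
    rw [action_cfg, this]
    rfl
  | cons a y ih =>
    intro m h w hy
    rcases m with _ | m
    · refine ⟨0, by omega, h, 0, 0, by simp [translateInputs], ?_⟩
      rw [action_cfg]
      have := hy 0
      simp only [Nat.add_zero, List.getElem?_cons_zero, Option.map_some] at this
      rw [this]
      cases a <;> rfl
    · have h0 := hy 0
      simp only [Nat.add_zero, List.getElem?_cons_zero, Option.map_some] at h0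
      obtain ⟨s, hs, h', m', p', h₁, h₂⟩ := ih m (h + 1) (w ++ valueSym a) fun i => by
        have := hy (i + 1)
        rwa [List.getElem?_cons_succ, show h + (i + 1) = h + 1 + i by omega] at this
      have e : translateInputs (m + 1) (a :: y) = valueSym a ++ translateInputs m y := by
        simp [translateInputs]
      rw [e, ← List.append_assoc]
      suffices H : ∃ n ≤ 2, (machine.step input)^[n] (cfg .translate h w (m + 1) (m + 1 - 1)) =
          cfg .translate (h + 1) (w ++ valueSym a) m (m - 1) by
        obtain ⟨n, hn, H⟩ := H
        refine ⟨s + n, by omega, h', m', p', ?_, h₂⟩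
        rw [Function.iterate_add_apply, H, h₁]
      have hp : m + 1 - 1 < m + 1 := by omega
      by_cases ha : a = .b1
      · subst ha
        refine ⟨2, le_rfl, ?_⟩
        have s₁ : machine.step input (cfg .translate h w (m + 1) (m + 1 - 1)) =
            cfg .one h (w ++ [.pos]) (m + 1) (m + 1 - 1) :=
          step_cfg (M := .stay) (M₀ := .right) (M₁ := .stay) (by decide)
            (by rw [h0, if_pos hp]; rfl) (update_output w .pos) (by simp [Move.apply])
            (update_counter_same (m + 1) (by omega))
        have s₂ : machine.step input (cfg .one h (w ++ [.pos]) (m + 1) (m + 1 - 1)) =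
            cfg .translate (h + 1) (w ++ [.pos] ++ [.b1]) m (m - 1) :=
          step_cfg (M := .right) (M₀ := .right) (M₁ := .left) (by decide)
            rfl (update_output _ .b1) (by simp [Move.apply])
            (update_counter_pred (m + 1))
        rw [Function.iterate_succ_apply, s₁, Function.iterate_one, s₂]
        simp [valueSym]
      · refine ⟨1, by omega, ?_⟩
        obtain ⟨c, hc⟩ : ∃ c, valueSym a = [c] ∧
            transition .translate (some (.inl a)) (some .fin) =
              some (act .translate .right (some c) none .right .left) := by
          cases a <;> first | exact absurd rfl ha | exact ⟨_, rfl, rfl⟩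
        rw [hc.1, Function.iterate_one]
        exact step_cfg (M := .right) (M₀ := .right) (M₁ := .left) (by decide)
          (by rw [h0, if_pos hp]; exact hc.2) (update_output w c) (by simp [Move.apply])
          (update_counter_pred (m + 1))

theorem outputsWithin (x y : List Letter) :
    machine.OutputsWithin (pairInput x y) (translateInputs x.length y) (3 * x.length + 1) := by
  obtain ⟨s, hs, h', m', p', h₁, h₂⟩ := iterate_translate (input := pairInput x y) y x.length
    (x.length + 1) [] fun i => by
      rw [pairInput, List.getElem?_append_right (by simp; omega)]
      simp [Nat.add_assoc, Nat.add_comm 1]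
  have e : (machine.step (pairInput x y))^[s + (1 + x.length)] machine.init =
      cfg .translate h' (translateInputs x.length y) m' p' := by
    rw [Function.iterate_add_apply, Function.iterate_add_apply, pairInput,
      iterate_count x.length le_rfl, ← pairInput, Function.iterate_one]
    have e₁ : (pairInput x y)[x.length]? = some (.inr ()) := by simp [pairInput]
    rw [step_cfg (s' := .translate) (M := .right) (M₀ := .stay) (M₁ := .left) (by decide)
      (by rw [e₁]; rfl) (update_output_none []) rfl (update_counter_none x.length)]
    exact h₁
  refine ⟨s + (1 + x.length), by omega, ?_, ?_⟩
  · rw [e]; exact h₂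
  · intro i
    rw [e]
    exact Option.map_id.symm ▸ rfl

end InputTranslator

theorem psTComputable_translateInputs :
    PsTComputable fun x y => translateInputs (rounds 0 x.length) y := by
  refine ⟨_, pTimeComputable_replicate_rounds, InputTranslator.machine,
    fun n => 3 * rounds 0 n + 1, ?_, fun x y => ?_⟩
  · have h1 : (fun _ : ℕ => (1 : ℝ)) =o[atTop] fun n : ℕ => (n : ℝ) :=
      isLittleO_const_left.2 (.inr (by
        simpa [Function.comp_def] using tendsto_natCast_atTop_atTop))
    simpa using (isLittleO_rounds.const_mul_left 3).add h1
  · simpa using InputTranslator.outputsWithin (List.replicate (rounds 0 x.length) .fin) y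

/-! ## Structured programs without shared memory for parallel machines -/

namespace PRAM

/-- The state of one processor: program counter, registers, and a log of its outputs. -/
structure LocalState where
  pc : ℕ
  reg : ℕ → ℕ
  log : List (ℕ × ℕ)

/-- The effect of an instruction on the registers, without access to the memory. -/
def regEffect (x : List Letter) (p : ℕ) (R : ℕ → ℕ) : PInstr → ℕ → ℕ
  | .const r v => Function.update R r v
  | .add r a b => Function.update R r (R a + R b)
  | .sub r a b => Function.update R r (R a - R b)
  | .half r a => Function.update R r (R a / 2)
  | .pid r => Function.update R r p
  | .len r => Function.update R r x.length
  | .input r a => Function.update R r ((x[R a]?).elim 0 Letter.code)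
  | _ => R

/-- The outputs of an instruction. -/
def outEffect (R : ℕ → ℕ) : PInstr → List (ℕ × ℕ)
  | .output b r => [(R b, R r)]
  | _ => []

/-- The next program counter. -/
def nextPc (pc : ℕ) (R : ℕ → ℕ) : PInstr → ℕ
  | .jz r l => if R r = 0 then l else pc + 1
  | _ => pc + 1

/-- A step of one processor, without access to the memory. -/
def localStep (prog : List PInstr) (x : List Letter) (p : ℕ) (c : LocalState) : LocalState :=
  match prog[c.pc]? with
  | none => c
  | some i => ⟨nextPc c.pc c.reg i, regEffect x p c.reg i, outEffect c.reg i ++ c.log⟩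

/-- The state of a processor after `s` steps. -/
def localRun (prog : List PInstr) (x : List Letter) (p s : ℕ) : LocalState :=
  (localStep prog x p)^[s] ⟨0, fun _ => 0, []⟩

/-- Whether an instruction reads the memory. -/
def IsLoad : PInstr → Prop
  | .load _ _ => True
  | _ => False

/-! ### Independence of the processors of a program that never reads the memory. -/

section Simulation

variable {prog : List PInstr} {procs : ℕ} {x : List Letter}

theorem localRun_succ (p s : ℕ) : localRun prog x p (s + 1) =
    localStep prog x p (localRun prog x p s) := Function.iterate_succ_apply' _ _ _

theorem iterate_step_eq (hp : ∀ i ∈ prog, ¬ IsLoad i) (s : ℕ) : ∀ p < procs,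
    ((step prog procs x)^[s] init).pc p = (localRun prog x p s).pc ∧
    ((step prog procs x)^[s] init).reg p = (localRun prog x p s).reg := by
  induction s with
  | zero => exact fun p _ => ⟨rfl, rfl⟩
  | succ s ih =>
    intro p hlt
    obtain ⟨h₁, h₂⟩ := ih p hlt
    rw [localRun_succ, Function.iterate_succ_apply']
    generalize (step prog procs x)^[s] init = c at *
    generalize localRun prog x p s = d at *
    simp only [step, if_pos hlt, stepPc, stepReg, instr, localStep, h₁, h₂]
    cases hi : prog[d.pc]? with
    | none => exact ⟨rfl, rfl⟩
    | some i =>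
      cases i <;> simp [nextPc, regEffect]
      exact (hp _ (List.mem_of_getElem? hi) trivial).elim

/-- Which processor wins a conflict need not be known: a cell holds a value that some processor has
logged for it, or it is untouched. -/
theorem out_iterate_step (hp : ∀ i ∈ prog, ¬ IsLoad i) (s a : ℕ) :
    (∃ p < procs, (a, ((step prog procs x)^[s] init).out a) ∈ (localRun prog x p s).log) ∨
    (((step prog procs x)^[s] init).out a = 0 ∧
      ∀ p < procs, ∀ v, (a, v) ∉ (localRun prog x p s).log) := by
  induction s with
  | zero => exact .inr ⟨rfl, fun p _ v => by simp [localRun]⟩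
  | succ s ih =>
    have hsub : ∀ p, ∀ e ∈ (localRun prog x p s).log, e ∈ (localRun prog x p (s + 1)).log := by
      intro p e he
      rw [localRun_succ, localStep]
      split
      · exact he
      · exact List.mem_append_right _ he
    have hw : ∀ p < procs, ∀ v, outWrite prog ((step prog procs x)^[s] init) a p = some v ↔
        ∃ i, prog[(localRun prog x p s).pc]? = some i ∧
          (a, v) ∈ outEffect (localRun prog x p s).reg i := by
      intro p hlt v
      obtain ⟨h₁, h₂⟩ := iterate_step_eq (procs := procs) (x := x) hp s p hlt
      simp only [outWrite, instr, h₁, h₂]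
      cases hi : prog[(localRun prog x p s).pc]? with
      | none => simp
      | some i =>
        cases i <;> simp [outEffect]
        rw [eq_comm (a := a), eq_comm (a := v)]
    rw [Function.iterate_succ_apply']
    change (∃ p < procs, (a, ((List.range procs).findSome?
      (outWrite prog ((step prog procs x)^[s] init) a)).getD
        (((step prog procs x)^[s] init).out a)) ∈ _) ∨ (((List.range procs).findSome?
      (outWrite prog ((step prog procs x)^[s] init) a)).getD
        (((step prog procs x)^[s] init).out a) = 0 ∧ _)
    cases hf : (List.range procs).findSome? (outWrite prog ((step prog procs x)^[s] init) a) with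
    | some v =>
      obtain ⟨p, hlt, hv⟩ := List.exists_of_findSome?_eq_some hf
      have hlt := List.mem_range.1 hlt
      obtain ⟨i, hi, hm⟩ := (hw p hlt v).1 hv
      refine .inl ⟨p, hlt, ?_⟩
      rw [localRun_succ, localStep, hi]
      exact List.mem_append_left _ hm
    | none =>
      rw [List.findSome?_eq_none_iff] at hf
      rcases ih with ⟨p, hlt, h⟩ | ⟨h₀, h⟩
      · exact .inl ⟨p, hlt, hsub p _ h⟩
      · refine .inr ⟨h₀, fun p hlt v hm => ?_⟩
        rw [localRun_succ, localStep] at hm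
        split at hm
        · exact h p hlt v hm
        · rename_i i hi
          rcases List.mem_append.1 hm with hm | hm
          · have := (hw p hlt v).2 ⟨i, hi, hm⟩
            rw [hf p (List.mem_range.2 hlt)] at this
            simp at this
          · exact h p hlt v hm

theorem localRun_halted {p s : ℕ} (h : prog[(localRun prog x p s).pc]? = none) (d : ℕ) :
    localRun prog x p (s + d) = localRun prog x p s := by
  induction d with
  | zero => rfl
  | succ d ih => rw [← Nat.add_assoc, localRun_succ, ih, localStep, h]

/-- A memory-free program computes `w` if its processors halt in time, have written the codes of
`w`, and nothing else. -/
theorem outputsWithin_of_localRun {w : List Letter} {T : ℕ} (hp : ∀ i ∈ prog, ¬ IsLoad i)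
    (run : ∀ p < procs, ∃ s ≤ T, prog[(localRun prog x p s).pc]? = none ∧
      ∀ a v, (a, v) ∈ (localRun prog x p s).log → w[a]?.map Letter.code = some v)
    (total : ∀ a < w.length, ∃ p < procs, ∀ s ≤ T, prog[(localRun prog x p s).pc]? = none →
      ∃ v, (a, v) ∈ (localRun prog x p s).log) :
    OutputsWithin prog procs x w T := by
  have run' : ∀ p < procs, prog[(localRun prog x p T).pc]? = none ∧
      ∀ a v, (a, v) ∈ (localRun prog x p T).log → w[a]?.map Letter.code = some v := by
    intro p hlt
    obtain ⟨s, hs, h₁, h₂⟩ := run p hlt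
    obtain ⟨d, rfl⟩ := Nat.exists_eq_add_of_le hs
    rw [localRun_halted h₁]
    exact ⟨h₁, h₂⟩
  refine ⟨T, le_rfl, fun p hlt => ?_, fun a ha => ?_⟩
  · rw [instr, (iterate_step_eq hp T p hlt).1]
    exact (run' p hlt).1
  · rcases out_iterate_step (procs := procs) (x := x) hp T a with ⟨p, hlt, h⟩ | ⟨h₀, h⟩
    · have := (run' p hlt).2 a _ h
      cases hw : w[a]? with
      | none => simp [hw] at this
      | some b => rw [hw] at this; exact (Option.some.inj this).symm
    · rw [h₀]
      rcases ha.lt_or_eq with ha | rfl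
      · obtain ⟨p, hlt, hs⟩ := total a ha
        obtain ⟨v, hv⟩ := hs T le_rfl (run' p hlt).1
        exact absurd hv (h p hlt v)
      · simp

end Simulation

/-- Structured programs. The jumps use the register `0`. -/
inductive Cmd : Type
  | skip
  | basic (i : PInstr)
  | seq (a b : Cmd)
  /-- if the register is `0` then the first, else the second program -/
  | ite (r : ℕ) (a b : Cmd)
  /-- repeat while the register is not `0` -/
  | loop (r : ℕ) (a : Cmd)

namespace Cmd

/-- The length of the compiled program. -/
def size : Cmd → ℕ
  | skip => 0
  | basic _ => 1
  | seq a b => a.size + b.size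
  | ite _ a b => b.size + a.size + 3
  | loop _ a => a.size + 3

/-- The instructions of a structured program that begins at the position `l`. -/
def compile (l : ℕ) : Cmd → List PInstr
  | skip => []
  | basic i => [i]
  | seq a b => a.compile l ++ b.compile (l + a.size)
  | ite r a b => .jz r (l + b.size + 3) :: (b.compile (l + 1) ++
      (.const 0 0 :: .jz 0 (l + b.size + a.size + 3) :: a.compile (l + b.size + 3)))
  | loop r a => .jz r (l + a.size + 3) :: (a.compile (l + 1) ++ [.const 0 0, .jz 0 l])

theorem length_compile (c : Cmd) : ∀ l, (c.compile l).length = c.size := by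
  induction c with
  | skip | basic i => intro l; rfl
  | seq a b iha ihb => intro l; simp [compile, size, iha, ihb]
  | ite r a b iha ihb => intro l; simp [compile, size, iha, ihb]; omega
  | loop r a ih => intro l; simp [compile, size, ih]

/-- Instructions that are neither jumps nor access the memory. -/
def Plain : PInstr → Bool
  | .jz _ _ | .load _ _ | .store _ _ => false
  | _ => true

/-- All basic instructions are plain. -/
def AllPlain : Cmd → Prop
  | skip => True
  | basic i => Plain i = true
  | seq a b => a.AllPlain ∧ b.AllPlain
  | ite _ a b => a.AllPlain ∧ b.AllPlain
  | loop _ a => a.AllPlain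

theorem AllPlain.not_isLoad {c : Cmd} : c.AllPlain → ∀ l, ∀ i ∈ c.compile l, ¬ IsLoad i := by
  induction c with
  | skip => simp [compile]
  | basic i => intro h l j hj; cases i <;> simp_all [compile, IsLoad, AllPlain, Plain]
  | seq a b iha ihb =>
    intro h l i hi
    rcases List.mem_append.1 hi with hi | hi
    exacts [iha h.1 _ i hi, ihb h.2 _ i hi]
  | ite r a b iha ihb =>
    intro h l i hi
    simp only [compile, List.mem_cons, List.mem_append] at hi
    rcases hi with rfl | hi | rfl | rfl | hi
    exacts [id, ihb h.2 _ i hi, id, id, iha h.1 _ i hi]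
  | loop r a ih =>
    intro h l i hi
    simp only [compile, List.mem_cons, List.mem_append, List.not_mem_nil, or_false] at hi
    rcases hi with rfl | hi | rfl | rfl
    exacts [id, ih h _ i hi, id, id]

/-- Registers and log. -/
abbrev Store : Type := (ℕ → ℕ) × List (ℕ × ℕ)

/-- The effect of an instruction. -/
def effect (x : List Letter) (p : ℕ) (σ : Store) (i : PInstr) : Store :=
  (regEffect x p σ.1 i, outEffect σ.1 i ++ σ.2)

/-- Clearing of the register `0`. -/
def clearZero (σ : Store) : Store := (Function.update σ.1 0 0, σ.2)

/-- Execution of a structured program, with the number of steps. -/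
inductive Exec (x : List Letter) (p : ℕ) : Cmd → Store → Store → ℕ → Prop
  | skip (σ) : Exec x p .skip σ σ 0
  | basic (i σ) (h : Plain i = true) : Exec x p (.basic i) σ (effect x p σ i) 1
  | seq {a b σ σ' σ'' t t'} : Exec x p a σ σ' t → Exec x p b σ' σ'' t' →
      Exec x p (.seq a b) σ σ'' (t + t')
  | ite_zero {r a b σ σ' t} : σ.1 r = 0 → Exec x p a σ σ' t → Exec x p (.ite r a b) σ σ' (1 + t)
  | ite_ne {r a b σ σ' t} : σ.1 r ≠ 0 → Exec x p b σ σ' t →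
      Exec x p (.ite r a b) σ (clearZero σ') (1 + t + 2)
  | loop_zero {r a σ} : σ.1 r = 0 → Exec x p (.loop r a) σ σ 1
  | loop_ne {r a σ σ' σ'' t t'} : σ.1 r ≠ 0 → Exec x p a σ σ' t →
      Exec x p (.loop r a) (clearZero σ') σ'' t' → Exec x p (.loop r a) σ σ'' (1 + t + 2 + t')

/-- The state of a processor with the given registers and log. -/
def atPc (l : ℕ) (σ : Store) : LocalState := ⟨l, σ.1, σ.2⟩

/-! ### Correctness of the compilation of structured programs. -/

section

variable {prog : List PInstr} {x : List Letter} {p : ℕ}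

theorem localStep_plain {l : ℕ} {σ : Store} {i : PInstr} (h : prog[l]? = some i)
    (hi : Plain i = true) : localStep prog x p (atPc l σ) = atPc (l + 1) (effect x p σ i) := by
  simp only [localStep, atPc, h, effect]
  cases i <;> first | rfl | simp [Plain] at hi

theorem localStep_jz {l r m : ℕ} {σ : Store} (h : prog[l]? = some (.jz r m)) :
    localStep prog x p (atPc l σ) = atPc (if σ.1 r = 0 then m else l + 1) σ := by
  simp only [localStep, atPc, h]
  rfl

theorem iterate_goto {l m : ℕ} {σ : Store} (h : prog[l]? = some (.const 0 0))
    (h' : prog[l + 1]? = some (.jz 0 m)) :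
    (localStep prog x p)^[2] (atPc l σ) = atPc m (clearZero σ) := by
  rw [Function.iterate_succ_apply, localStep_plain h rfl, Function.iterate_one, localStep_jz h']
  simp [effect, regEffect, outEffect, clearZero]

/-- Jump targets are absolute, so the code is considered inside a larger program, compiled for its
actual position. The two extra steps after an else branch or a loop body are an unconditional jump:
clear register `0`, then test it. -/
theorem Exec.iterate {c : Cmd} {σ σ' : Store} {t : ℕ} (h : Exec x p c σ σ' t) :
    ∀ pre post : List PInstr, prog = pre ++ (c.compile pre.length ++ post) →
      (localStep prog x p)^[t] (atPc pre.length σ) = atPc (pre.length + c.size) σ' := by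
  induction h with
  | skip σ => intros; rfl
  | basic i σ hi =>
    rintro pre post rfl
    exact localStep_plain (by simp [compile]) hi
  | @seq a b σ σ' σ'' t t' _ _ iha ihb =>
    rintro pre post rfl
    have h₁ := iha pre (b.compile (pre.length + a.size) ++ post) (by simp [compile])
    have h₂ := ihb (pre ++ a.compile pre.length) post (by simp [compile, length_compile])
    rw [List.length_append, length_compile] at h₂
    rw [Nat.add_comm t, Function.iterate_add_apply, h₁, h₂, size, Nat.add_assoc]
  | @ite_zero r a b σ σ' t hr _ ih =>
    rintro pre post rfl
    have h := ih (pre ++ .jz r (pre.length + b.size + 3) :: (b.compile (pre.length + 1) ++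
      [.const 0 0, .jz 0 (pre.length + b.size + a.size + 3)])) post
      (by simp [compile, length_compile]; rfl)
    have e : (pre ++ PInstr.jz r (pre.length + b.size + 3) :: (b.compile (pre.length + 1) ++
      [.const 0 0, .jz 0 (pre.length + b.size + a.size + 3)])).length =
        pre.length + b.size + 3 := by simp [length_compile]; omega
    rw [e] at h
    rw [Nat.add_comm 1, Function.iterate_add_apply, Function.iterate_one,
      localStep_jz (r := r) (m := pre.length + b.size + 3) (by simp [compile]), if_pos hr, h]
    simp [size]; congr 1; omega
  | @ite_ne r a b σ σ' t hr _ ih =>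
    rintro pre post rfl
    have h := ih (pre ++ [.jz r (pre.length + b.size + 3)]) (.const 0 0 ::
      .jz 0 (pre.length + b.size + a.size + 3) :: (a.compile (pre.length + b.size + 3) ++ post))
      (by simp [compile])
    have e : (pre ++ [PInstr.jz r (pre.length + b.size + 3)]).length = pre.length + 1 := by simp
    rw [e] at h
    rw [Nat.add_comm (1 + t), Nat.add_comm 1, Function.iterate_add_apply,
      Function.iterate_add_apply, Function.iterate_one,
      localStep_jz (r := r) (m := pre.length + b.size + 3) (by simp [compile]), if_neg hr, h,
      iterate_goto (m := pre.length + b.size + a.size + 3)]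
    · simp [size]; congr 1; omega
    · rw [List.getElem?_append_right (by omega)]
      simp [compile, length_compile, Nat.add_assoc, Nat.add_comm 1]
    · rw [List.getElem?_append_right (by omega)]
      simp only [compile, Nat.add_assoc, Nat.add_comm 1, Nat.add_sub_cancel_left,
        List.cons_append, List.getElem?_cons_succ, List.append_assoc]
      rw [List.getElem?_append_right (by rw [length_compile]; omega), length_compile]
      simp
  | @loop_zero r a σ hr =>
    rintro pre post rfl
    rw [Function.iterate_one, localStep_jz (r := r) (m := pre.length + a.size + 3)
      (by simp [compile]), if_pos hr]
    simp [size, Nat.add_assoc]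
  | @loop_ne r a σ σ' σ'' t t' hr _ _ ih ih' =>
    rintro pre post rfl
    have h := ih (pre ++ [.jz r (pre.length + a.size + 3)])
      (.const 0 0 :: .jz 0 pre.length :: post) (by simp [compile])
    have e : (pre ++ [PInstr.jz r (pre.length + a.size + 3)]).length = pre.length + 1 := by simp
    rw [e] at h
    rw [Nat.add_comm _ t', Function.iterate_add_apply, Nat.add_comm (1 + t), Nat.add_comm 1,
      Function.iterate_add_apply, Function.iterate_add_apply, Function.iterate_one,
      localStep_jz (r := r) (m := pre.length + a.size + 3) (by simp [compile]), if_neg hr, h,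
      iterate_goto (m := pre.length), ih' pre post rfl]
    · rw [List.getElem?_append_right (by omega)]
      simp [compile, length_compile, Nat.add_assoc, Nat.add_comm 1]
    · rw [List.getElem?_append_right (by omega)]
      simp [compile, length_compile, Nat.add_assoc, Nat.add_comm 1]

theorem Exec.localRun {c : Cmd} {σ : Store} {t : ℕ}
    (h : Exec x p c (fun _ => 0, []) σ t) : localRun (c.compile 0) x p t = atPc c.size σ := by
  have := h.iterate (prog := c.compile 0) [] [] (by simp)
  rw [List.length_nil, Nat.zero_add] at this
  exact this

end

/-- A sequence of instructions. -/
def block : List PInstr → Cmd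
  | [] => skip
  | i :: l => seq (basic i) (block l)

theorem exec_block {x : List Letter} {p : ℕ} : ∀ (l : List PInstr) (σ : Store),
    l.all Plain = true → Exec x p (block l) σ (l.foldl (effect x p) σ) l.length
  | [], σ, _ => .skip σ
  | i :: l, σ, h => by
    simp only [List.all_cons, Bool.and_eq_true] at h
    rw [List.length_cons, Nat.add_comm]
    exact .seq (.basic i σ h.1) (exec_block l _ h.2)

theorem allPlain_block : ∀ {l : List PInstr}, l.all Plain = true → (block l).AllPlain
  | [], _ => trivial
  | i :: l, h => by
    simp only [List.all_cons, Bool.and_eq_true] at h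
    exact ⟨h.1, allPlain_block h.2⟩

end Cmd

end PRAM

namespace PRAM

/-! ## The parallel program for the translation -/

/-- Decision trees that choose a block by testing registers for given values. -/
inductive Tree : Type
  | leaf (b : List Letter)
  | test (r v : ℕ) (yes no : Tree)

namespace Tree

/-- The chosen block. -/
def eval (R : ℕ → ℕ) : Tree → List Letter
  | leaf b => b
  | test r v yes no => if R r = v then yes.eval R else no.eval R

/-- The tested registers are among `3, 5, 6, 9`. -/
def Ok : Tree → Prop
  | leaf _ => True
  | test r _ yes no => (r = 3 ∨ r = 5 ∨ r = 6 ∨ r = 9) ∧ yes.Ok ∧ no.Ok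

/-- The program that puts the codes of the padded block into the registers `20, …, 28`. -/
def cmd : Tree → Cmd
  | leaf b => .block [.const 20 (b.getD 0 .blank).code, .const 21 (b.getD 1 .blank).code,
      .const 22 (b.getD 2 .blank).code, .const 23 (b.getD 3 .blank).code,
      .const 24 (b.getD 4 .blank).code, .const 25 (b.getD 5 .blank).code,
      .const 26 (b.getD 6 .blank).code, .const 27 (b.getD 7 .blank).code,
      .const 28 (b.getD 8 .blank).code]
  | test r v yes no => .seq
      (.block [.const 13 v, .sub 11 r 13, .sub 13 13 r, .add 11 11 13]) (.ite 11 yes.cmd no.cmd)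

/-- A bound for the running time. -/
def cost : Tree → ℕ
  | leaf _ => 9
  | test _ _ yes no => max yes.cost no.cost + 7

theorem eval_congr {R R' : ℕ → ℕ} (h₃ : R' 3 = R 3) (h₅ : R' 5 = R 5) (h₆ : R' 6 = R 6)
    (h₉ : R' 9 = R 9) : ∀ {t : Tree}, t.Ok → t.eval R' = t.eval R
  | leaf _, _ => rfl
  | test r v yes no, h => by
    have hr : R' r = R r := by obtain ⟨rfl | rfl | rfl | rfl, -⟩ := h <;> assumption
    rw [eval, eval, hr, eval_congr h₃ h₅ h₆ h₉ h.2.1, eval_congr h₃ h₅ h₆ h₉ h.2.2]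

theorem allPlain_cmd : ∀ t : Tree, t.cmd.AllPlain
  | leaf _ => Cmd.allPlain_block rfl
  | test _ _ yes no => ⟨Cmd.allPlain_block rfl, allPlain_cmd yes, allPlain_cmd no⟩

theorem exec_cmd {x : List Letter} {p : ℕ} (L : List (ℕ × ℕ)) : ∀ {t : Tree}, t.Ok → ∀ R : ℕ → ℕ,
    ∃ R', ∃ n ≤ t.cost, Cmd.Exec x p t.cmd (R, L) (R', L) n ∧
      (∀ j < 9, R' (20 + j) = ((t.eval R).getD j .blank).code) ∧ R' 10 = R 10 ∧ R' 12 = R 12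
  | leaf b, _, R => by
    refine ⟨_, 9, le_rfl, Cmd.exec_block _ (R, L) rfl, ?_, ?_, ?_⟩
    · intro j hj
      interval_cases j <;> simp [Cmd.effect, regEffect, Function.update, eval]
    · simp [Cmd.effect, regEffect, Function.update]
    · simp [Cmd.effect, regEffect, Function.update]
  | test r v yes no, ⟨hr, hy, hn⟩, R => by
    set l : List PInstr := [.const 13 v, .sub 11 r 13, .sub 13 13 r, .add 11 11 13] with hl
    obtain ⟨R₁, hR₁⟩ : ∃ R₁, l.foldl (Cmd.effect x p) (R, L) = (R₁, L) := ⟨_, rfl⟩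
    have h₁ : Cmd.Exec x p (.block l) (R, L) (R₁, L) 4 := hR₁ ▸ Cmd.exec_block l (R, L) rfl
    -- The sum of the two truncated differences is the distance of `R r` from `v`, which is 0
    -- exactly for equality. The scratch registers 11 and 13 are never tested by the tree.
    have e : R₁ = Function.update (Function.update R 13 (v - R r)) 11 ((R r - v) + (v - R r)) := by
      have := (congrArg Prod.fst hR₁).symm
      have hr' : r ≠ 11 ∧ r ≠ 13 := by omega
      refine Eq.trans this ?_
      funext k
      by_cases k₁ : k = 11 <;> by_cases k₂ : k = 13 <;>
        simp [hl, Cmd.effect, regEffect, Function.update, k₁, k₂, hr'.1, hr'.2]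
    have hc : ∀ {t : Tree}, t.Ok → t.eval R₁ = t.eval R := by
      apply eval_congr <;> simp [e]
    have h10 : R₁ 10 = R 10 := by simp [e, Function.update]
    have h12 : R₁ 12 = R 12 := by simp [e, Function.update]
    have h11 : R₁ 11 = 0 ↔ R r = v := by simp [e]; omega
    by_cases hv : R r = v
    · obtain ⟨R', n, hn', h₂, h₃, h₄, h₅⟩ := exec_cmd L hy R₁
      refine ⟨R', _, ?_, .seq h₁ (.ite_zero (h11.2 hv) h₂), ?_, h₄.trans h10, h₅.trans h12⟩
      · rw [cost]; omega
      · rw [eval, if_pos hv, ← hc hy]; exact h₃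
    · obtain ⟨R', n, hn', h₂, h₃, h₄, h₅⟩ := exec_cmd L hn R₁
      refine ⟨_, _, ?_, .seq h₁ (.ite_ne (mt h11.1 hv) h₂), ?_, ?_, ?_⟩
      · rw [cost]; omega
      · intro j hj
        rw [eval, if_neg hv, ← hc hn, ← h₃ j hj]
        exact Function.update_of_ne (by omega) _ _
      · exact h₄.trans h10
      · exact h₅.trans h12

end Tree

/-- The blocks of the node list. -/
def defTree : Tree :=
  .test 5 0 (.leaf [.eql]) <| .test 5 1 (.leaf [.b0]) <| .test 5 2 (.leaf [.b1]) <|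
  .test 5 3 (.leaf [.inp]) <| .test 5 8 (.leaf [.fin]) <|
  .test 5 4 (.leaf [.asg, .times, .ref]) <|
  .test 5 5 (.leaf [.asg, .minus, .pos, .b1, .times, .minus, .pos, .b1, .ref]) <|
  .test 5 6 (.leaf [.asg, .minus, .pos, .b1, .ref]) <|
  .test 5 7 (.test 9 4 (.leaf [.ref]) <| .test 9 5 (.leaf [.minus, .pos, .b1, .ref]) <|
    .leaf [.comma]) <|
  .leaf [.comma]

/-- The blocks of the operators of the chain term. -/
def opTree : Tree :=
  .test 5 0 (.leaf [.ref]) <|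
  .test 5 8 (.test 6 0 (.leaf []) (.leaf [.plus, .times])) <| .leaf []

/-- The blocks of the references of the chain term. -/
def refTree : Tree :=
  .test 5 0 (.leaf [.pos, .b1, .fin]) <|
  .test 5 8 (.test 6 0 (.leaf []) (.leaf [.pos, .ref])) <|
  .test 5 1 (.test 9 0 (.leaf [.b0]) <| .test 9 8 (.leaf [.b0]) <| .leaf []) <|
  .test 5 2 (.test 9 0 (.leaf [.b1]) <| .test 9 8 (.leaf [.b1]) <| .leaf []) <| .leaf []

/-- All blocks. -/
def blockTree : Tree := .test 3 0 defTree <| .test 3 1 opTree refTree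

theorem blockTree_ok : blockTree.Ok := by
  simp [blockTree, defTree, opTree, refTree, Tree.Ok]

theorem eval_blockTree {R : ℕ → ℕ} {o next : Option Letter} (h₅ : R 5 = o.elim 0 Letter.code)
    (h₆ : R 6 = next.elim 0 Letter.code) :
    blockTree.eval R = areaBlock (R 3) (R 9) o next := by
  have h₆' : R 6 = 0 ↔ next = none := by
    rw [h₆]
    rcases next with _ | a
    · simp
    · cases a <;> simp [Letter.code]
  rw [blockTree, Tree.eval, Tree.eval, areaBlock]
  congr 1
  · rcases o with _ | a
    · simp [defTree, Tree.eval, h₅, defBlock]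
    · cases a <;> simp [defTree, Tree.eval, h₅, defBlock, Letter.code]
  · congr 1
    · rcases o with _ | a
      · simp [opTree, Tree.eval, h₅, opBlock]
      · cases a <;> simp [opTree, Tree.eval, h₅, opBlock, Letter.code]
        rcases next with _ | b <;> simp [h₆']
    · rcases o with _ | a
      · simp [refTree, Tree.eval, h₅, refBlock]
      · cases a <;> simp [refTree, Tree.eval, h₅, refBlock, Letter.code]
        · by_cases h0 : R 9 = 0 <;> simp [h0]
        · by_cases h0 : R 9 = 0 <;> simp [h0]
        · rcases next with _ | b <;> simp [h₆']

/-- Subtraction of the length of an area from the position, if possible. -/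
def nextArea : Cmd :=
  .seq (.block [.sub 11 2 4]) (.ite 11 (.block [.sub 4 4 2, .add 3 3 12]) .skip)

theorem exec_nextArea {x : List Letter} {p : ℕ} (L : List (ℕ × ℕ)) (R : ℕ → ℕ) :
    ∃ R', ∃ n ≤ 6, Cmd.Exec x p nextArea (R, L) (R', L) n ∧
      R' 4 = (if R 4 < R 2 then R 4 else R 4 - R 2) ∧
      R' 3 = (if R 4 < R 2 then R 3 else R 3 + R 12) ∧
      ∀ j, j ≠ 0 → j ≠ 3 → j ≠ 4 → j ≠ 11 → R' j = R j := by
  have h₁ : Cmd.Exec x p (.block [.sub 11 2 4]) (R, L)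
      (Function.update R 11 (R 2 - R 4), L) 1 := Cmd.exec_block _ (R, L) rfl
  by_cases h : R 4 < R 2
  · refine ⟨_, _, ?_, .seq h₁ (.ite_ne ?_ (.skip _)), ?_, ?_, ?_⟩
    · omega
    · simp; omega
    · simp [h, Function.update]
    · simp [h, Function.update]
    · intro j h₀ h₃ h₄ h₁₁
      simp [Function.update, h₀, h₁₁]
  · refine ⟨_, _, ?_, .seq h₁ (.ite_zero ?_ (Cmd.exec_block _ (_, L) rfl)), ?_, ?_, ?_⟩
    · simp
    · simp; omega
    · simp [h, Function.update, Cmd.effect, regEffect]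
    · simp [h, Function.update, Cmd.effect, regEffect]
    · intro j h₀ h₃ h₄ h₁₁
      simp [Function.update, Cmd.effect, regEffect, h₃, h₄, h₁₁]

/-- The body of the search for a non-digit. -/
def searchBody : Cmd :=
  .ite 7 (.block [.const 9 0, .const 8 0]) <|
    .seq (.block [.sub 7 7 12, .input 9 7, .const 13 2, .sub 11 9 13]) <|
      .ite 11 (.block [.half 8 8]) (.block [.const 8 0])

/-- Register 8 is halved in each pass of the search loop, so its size counts the passes that remain.
-/
theorem size_eq_size_half {b : ℕ} (hb : b ≠ 0) : b.size = (b / 2).size + 1 := by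
  have h := Nat.size_bit (b := b.bodd) (n := b.div2) (by rwa [Nat.bit_bodd_div2])
  rwa [Nat.bit_bodd_div2, Nat.div2_val] at h

/-- The fuel of `scan` is the size of register 8. The start of the string or a non-digit ends the
loop by setting that register to 0; a digit only halves it. A pass takes at most 14 steps, and the
final test of the loop one more. -/
theorem exec_search {x : List Letter} {p : ℕ} (L : List (ℕ × ℕ)) : ∀ (k : ℕ) (R : ℕ → ℕ),
    (R 8).size = k → R 7 ≤ x.length → R 12 = 1 →
    ∃ R', ∃ n ≤ 14 * k + 1, Cmd.Exec x p (.loop 8 searchBody) (R, L) (R', L) n ∧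
      R' 9 = scan (R 9) k (x.take (R 7)).reverse ∧
      ∀ j, j ≠ 0 → j ≠ 7 → j ≠ 8 → j ≠ 9 → j ≠ 11 → j ≠ 13 → R' j = R j := by
  intro k
  induction k with
  | zero =>
    intro R h₈ h₇ h₁₂
    exact ⟨R, 1, by omega, .loop_zero (Nat.size_eq_zero.1 h₈), rfl, fun _ _ _ _ _ _ _ => rfl⟩
  | succ k ih =>
    intro R h₈ h₇ h₁₂
    have h₈' : R 8 ≠ 0 := by
      intro h
      rw [h] at h₈
      simp at h₈
    have halt : ∀ R' : ℕ → ℕ, R' 8 = 0 →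
        Cmd.Exec x p (.loop 8 searchBody) (Cmd.clearZero (R', L)) (Cmd.clearZero (R', L)) 1 :=
      fun R' h => .loop_zero (by simpa [Cmd.clearZero] using h)
    by_cases ha : R 7 = 0
    · refine ⟨_, _, ?_, .loop_ne h₈' (.ite_zero ha (Cmd.exec_block _ (R, L) rfl))
        (halt _ ?_), ?_, ?_⟩
      · simp; omega
      · simp [regEffect, Function.update]
      · simp [Cmd.effect, regEffect, Function.update, ha, scan]
      · intro j h₀ h₇ h₈ h₉ h₁₁ h₁₃
        simp [Cmd.effect, regEffect, Function.update, h₀, h₈, h₉]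
    · obtain ⟨a, ha⟩ := Nat.exists_eq_succ_of_ne_zero ha
      have hax : a < x.length := by omega
      have htake : (x.take (R 7)).reverse = x[a] :: (x.take a).reverse := by
        rw [ha, List.take_succ_eq_append_getElem hax, List.reverse_append]
        rfl
      set l : List PInstr := [.sub 7 7 12, .input 9 7, .const 13 2, .sub 11 9 13] with hl
      obtain ⟨R₁, hR₁⟩ : ∃ R₁, l.foldl (Cmd.effect x p) (R, L) = (R₁, L) := ⟨_, rfl⟩
      have h₁ : Cmd.Exec x p (.block l) (R, L) (R₁, L) 4 := hR₁ ▸ Cmd.exec_block l (R, L) rfl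
      have e : R₁ = _ := (congrArg Prod.fst hR₁).symm
      have e₇ : R₁ 7 = a := by
        rw [e]; simp [hl, Cmd.effect, regEffect, Function.update, ha, h₁₂]
      have e₈ : R₁ 8 = R 8 := by
        rw [e]; simp [hl, Cmd.effect, regEffect, Function.update]
      have e₉ : R₁ 9 = x[a].code := by
        rw [e]; simp [hl, Cmd.effect, regEffect, Function.update, ha, h₁₂, hax]
      have e₁₁ : R₁ 11 = x[a].code - 2 := by
        rw [e]; simp [hl, Cmd.effect, regEffect, Function.update, ha, h₁₂, hax]
      have e' : ∀ j, j ≠ 7 → j ≠ 9 → j ≠ 11 → j ≠ 13 → R₁ j = R j := by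
        intro j h₇ h₉ h₁₁ h₁₃
        rw [e]; simp [hl, Cmd.effect, regEffect, Function.update, h₇, h₉, h₁₁, h₁₃]
      have h₇' : R 7 ≠ 0 := by omega
      rw [htake]
      by_cases hd : x[a].code ≤ 2
      · have h₂ : Cmd.Exec x p (.block [.half 8 8]) (R₁, L)
            (Function.update R₁ 8 (R₁ 8 / 2), L) 1 := Cmd.exec_block _ (R₁, L) rfl
        obtain ⟨R', n, hn, h₃, h₄, h₅⟩ := ih (Function.update (Function.update (Function.update
          R₁ 8 (R₁ 8 / 2)) 0 0) 0 0)
          (by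
            rw [size_eq_size_half h₈'] at h₈
            simpa [Function.update, e₈] using h₈)
          (by simp [Function.update, e₇]; omega)
          (by simp [Function.update, e', h₁₂])
        refine ⟨R', _, ?_, .loop_ne h₈' (.ite_ne h₇' (.seq h₁ (.ite_zero ?_ h₂))) h₃, ?_, ?_⟩
        · omega
        · simp [e₁₁, hd]
        · rw [h₄]
          simp [scan, hd, Function.update, e₇, e₉]
        · intro j h₀ h₇ h₈ h₉ h₁₁ h₁₃
          rw [h₅ j h₀ h₇ h₈ h₉ h₁₁ h₁₃]
          simp [Function.update, h₀, h₈, e' j h₇ h₉ h₁₁ h₁₃]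
      · have h₂ : Cmd.Exec x p (.block [.const 8 0]) (R₁, L)
            (Function.update R₁ 8 0, L) 1 := Cmd.exec_block _ (R₁, L) rfl
        refine ⟨_, _, ?_, .loop_ne h₈' (.ite_ne h₇' (.seq h₁ (.ite_ne ?_ h₂))) (halt _ ?_), ?_, ?_⟩
        · omega
        · simp [e₁₁]; omega
        · simp [Cmd.clearZero, Function.update]
        · simp [Cmd.clearZero, Function.update, e₉, scan, hd]
        · intro j h₀ h₇ h₈ h₉ h₁₁ h₁₃
          simp [Cmd.clearZero, Function.update, h₀, h₈, e' j h₇ h₉ h₁₁ h₁₃]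

/-- The registers `1`: number of the processor, `2`: length of an area, `3`: area, `4`: position
in the area, `7`, `8`, `9`: position, bound and result of the search, `10`: output address,
`12`: the constant `1`. -/
def prelude : Cmd :=
  .block [.const 12 1, .len 2, .add 8 2 2, .add 8 8 12, .add 2 2 12, .pid 4, .add 10 4 4,
    .add 10 10 10, .add 10 10 10, .add 10 10 4, .const 3 0, .const 9 1]

/-- Output of the registers `20, …, 28`. -/
def emit : Cmd :=
  .block [.output 10 20, .add 10 10 12, .output 10 21, .add 10 10 12, .output 10 22,
    .add 10 10 12, .output 10 23, .add 10 10 12, .output 10 24, .add 10 10 12, .output 10 25,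
    .add 10 10 12, .output 10 26, .add 10 10 12, .output 10 27, .add 10 10 12, .output 10 28]

/-- The work of a processor that is responsible for a block. -/
def blockCmd : Cmd :=
  .seq (.block [.input 5 4, .add 11 4 12, .input 6 11, .const 14 0, .add 7 4 14]) <|
    .seq (.loop 8 searchBody) <| .seq blockTree.cmd emit

/-- The program of the translation. -/
def reductionCmd : Cmd :=
  .seq prelude <| .seq nextArea <| .seq nextArea <| .seq nextArea <|
    .seq (.block [.const 13 2, .sub 11 3 13]) <| .ite 11 blockCmd .skip

theorem allPlain_reductionCmd : reductionCmd.AllPlain := by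
  have h : nextArea.AllPlain := ⟨Cmd.allPlain_block rfl, Cmd.allPlain_block rfl, trivial⟩
  exact ⟨Cmd.allPlain_block rfl, h, h, h, Cmd.allPlain_block rfl,
    ⟨Cmd.allPlain_block rfl, ⟨Cmd.allPlain_block rfl, Cmd.allPlain_block rfl,
      Cmd.allPlain_block rfl, Cmd.allPlain_block rfl⟩, Tree.allPlain_cmd _,
      Cmd.allPlain_block rfl⟩, trivial⟩

theorem exec_emit {x : List Letter} {p : ℕ} (R : ℕ → ℕ) (h : R 12 = 1) :
    ∃ R', ∃ L, Cmd.Exec x p emit (R, []) (R', L) 17 ∧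
      ∀ a v, (a, v) ∈ L ↔ ∃ j < 9, a = R 10 + j ∧ v = R (20 + j) := by
  refine ⟨_, _, Cmd.exec_block _ (R, []) rfl, fun a v => ?_⟩
  simp only [Cmd.effect, regEffect, outEffect, Function.update,
    List.cons_append, List.nil_append]
  simp only [h, Nat.reduceEqDiff, eq_rec_constant, dite_eq_ite,
    if_false, List.mem_cons, Prod.mk.injEq, List.not_mem_nil, or_false]
  constructor
  · rintro (h | h | h | h | h | h | h | h | h)
    exacts [⟨8, by omega, h⟩, ⟨7, by omega, h⟩, ⟨6, by omega, h⟩, ⟨5, by omega, h⟩,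
      ⟨4, by omega, h⟩, ⟨3, by omega, h⟩, ⟨2, by omega, h⟩, ⟨1, by omega, h⟩, ⟨0, by omega, h⟩]
  · rintro ⟨j, hj, h⟩
    interval_cases j <;> simp_all

theorem cost_blockTree : blockTree.cost ≤ 100 := by decide

theorem exec_blockCmd {x : List Letter} {p : ℕ} (R : ℕ → ℕ) (h₄ : R 4 ≤ x.length)
    (h₉ : R 9 = 1) (h₁₂ : R 12 = 1) :
    ∃ R' L, ∃ n ≤ 14 * (R 8).size + 123, Cmd.Exec x p blockCmd (R, []) (R', L) n ∧
      ∀ a v, (a, v) ∈ L ↔ ∃ j < 9, a = R 10 + j ∧ v = ((areaBlock (R 3)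
        (scan 1 (R 8).size (x.take (R 4)).reverse) x[R 4]? x[R 4 + 1]?).getD j .blank).code := by
  set l : List PInstr := [.input 5 4, .add 11 4 12, .input 6 11, .const 14 0, .add 7 4 14] with hl
  obtain ⟨R₁, hR₁⟩ : ∃ R₁, l.foldl (Cmd.effect x p) (R, []) = (R₁, []) := ⟨_, rfl⟩
  have x₁ : Cmd.Exec x p (.block l) (R, []) (R₁, []) 5 := hR₁ ▸ Cmd.exec_block l (R, []) rfl
  have e : R₁ = _ := (congrArg Prod.fst hR₁).symm
  have e₅ : R₁ 5 = (x[R 4]?).elim 0 Letter.code := by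
    rw [e]; simp [hl, Cmd.effect, regEffect, Function.update]
  have e₆ : R₁ 6 = (x[R 4 + 1]?).elim 0 Letter.code := by
    rw [e]; simp [hl, Cmd.effect, regEffect, Function.update, h₁₂]
  have e₇ : R₁ 7 = R 4 := by
    rw [e]; simp [hl, Cmd.effect, regEffect, Function.update]
  have e' : ∀ j, j = 3 ∨ j = 8 ∨ j = 9 ∨ j = 10 ∨ j = 12 → R₁ j = R j := by
    rw [e]
    rintro j (rfl | rfl | rfl | rfl | rfl) <;> simp [hl, Cmd.effect, regEffect, Function.update]
  obtain ⟨R₂, n₂, hn₂, x₂, f₉, f⟩ := exec_search (x := x) (p := p) [] _ R₁ rfl (by omega)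
    (by rw [e' 12 (by simp), h₁₂])
  rw [e' 8 (by simp)] at hn₂ f₉
  rw [e' 9 (by simp), h₉, e₇] at f₉
  obtain ⟨R₃, n₃, hn₃, x₃, g, g₁₀, g₁₂⟩ := Tree.exec_cmd (x := x) (p := p) [] blockTree_ok R₂
  obtain ⟨R₄, L, x₄, hL⟩ := exec_emit (x := x) (p := p) R₃ (by
    rw [g₁₂, f 12 (by decide) (by decide) (by decide) (by decide) (by decide) (by decide),
      e' 12 (by simp), h₁₂])
  have hc := cost_blockTree
  refine ⟨R₄, L, _, ?_, .seq x₁ (.seq x₂ (.seq x₃ x₄)), fun a v => ?_⟩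
  · omega
  · have hb : blockTree.eval R₂ = areaBlock (R 3) (scan 1 (R 8).size (x.take (R 4)).reverse)
        x[R 4]? x[R 4 + 1]? := by
      rw [eval_blockTree (o := x[R 4]?) (next := x[R 4 + 1]?), f₉,
        f 3 (by decide) (by decide) (by decide) (by decide) (by decide) (by decide),
        e' 3 (by simp)]
      · rw [f 5 (by decide) (by decide) (by decide) (by decide) (by decide) (by decide), e₅]
      · rw [f 6 (by decide) (by decide) (by decide) (by decide) (by decide) (by decide), e₆]
    rw [hL, g₁₀, f 10 (by decide) (by decide) (by decide) (by decide) (by decide) (by decide),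
      e' 10 (by simp), ← hb]
    exact exists_congr fun j => and_congr_right fun hj => by rw [g j hj]

theorem exec_reductionCmd (x : List Letter) (p : ℕ) :
    ∃ R L, ∃ n ≤ 14 * searchBound x.length + 170,
      Cmd.Exec x p reductionCmd (fun _ => 0, []) (R, L) n ∧
      ∀ a v, (a, v) ∈ L ↔ p < 3 * (x.length + 1) ∧ ∃ j < 9, a = 9 * p + j ∧
        v = ((numberedBlock x p).getD j .blank).code := by
  obtain ⟨R₁, x₁, e₂, e₃, e₄, e₈, e₉, e₁₀, e₁₂⟩ : ∃ R₁ : ℕ → ℕ,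
      Cmd.Exec x p prelude (fun _ => 0, []) (R₁, []) 12 ∧ R₁ 2 = x.length + 1 ∧ R₁ 3 = 0 ∧
      R₁ 4 = p ∧ R₁ 8 = 2 * x.length + 1 ∧ R₁ 9 = 1 ∧ R₁ 10 = 9 * p ∧ R₁ 12 = 1 := by
    refine ⟨_, Cmd.exec_block _ (_, []) rfl, ?_⟩
    simp [Cmd.effect, regEffect, Function.update]
    omega
  obtain ⟨R₂, n₂, hn₂, x₂, f₄, f₃, f⟩ := exec_nextArea (x := x) (p := p) [] R₁
  obtain ⟨R₃, n₃, hn₃, x₃, g₄, g₃, g⟩ := exec_nextArea (x := x) (p := p) [] R₂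
  obtain ⟨R₄, n₄, hn₄, x₄, h₄, h₃, h⟩ := exec_nextArea (x := x) (p := p) [] R₃
  have k : ∀ j, j = 2 ∨ j = 8 ∨ j = 9 ∨ j = 10 ∨ j = 12 → R₂ j = R₁ j ∧ R₃ j = R₁ j ∧
      R₄ j = R₁ j := by
    intro j hj
    rw [h j (by omega) (by omega) (by omega) (by omega),
      g j (by omega) (by omega) (by omega) (by omega),
      f j (by omega) (by omega) (by omega) (by omega)]
    simp
  simp only [(k 2 (by simp)).2.1, (k 12 (by simp)).2.1, (k 2 (by simp)).1, (k 12 (by simp)).1,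
    e₂, e₃, e₄, e₁₂] at f₄ f₃ g₄ g₃ h₄ h₃
  set N := x.length + 1 with hN
  have x₅ : Cmd.Exec x p (.block [.const 13 2, .sub 11 3 13]) (R₄, [])
      (Function.update (Function.update R₄ 13 2) 11 (R₄ 3 - 2), []) 2 := by
    have := Cmd.exec_block (x := x) (p := p) [.const 13 2, .sub 11 3 13] (R₄, []) rfl
    simpa [Cmd.effect, regEffect, outEffect, Function.update] using this
  by_cases hp : p < 3 * N
  · have hq : R₄ 3 = p / N ∧ R₄ 4 = p % N := by
      have d₁ : p / N * N + p % N = p := Nat.div_add_mod' p N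
      have d₂ : p % N < N := Nat.mod_lt _ (by omega)
      have d₃ : p / N < 3 := Nat.div_lt_of_lt_mul (by rwa [Nat.mul_comm])
      generalize p / N = q at *
      generalize p % N = r at *
      -- The quotient is at most 2, so three conditional subtractions carry out the division by `N`.
      interval_cases q <;> (split_ifs at * <;> omega)
    have d₂ : p % N < N := Nat.mod_lt _ (by omega)
    have d₃ : p / N < 3 := Nat.div_lt_of_lt_mul (by rwa [Nat.mul_comm])
    obtain ⟨R₅, L, n₅, hn₅, x₆, hL⟩ := exec_blockCmd (x := x) (p := p)
      (Function.update (Function.update R₄ 13 2) 11 (R₄ 3 - 2))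
      (by simp [Function.update]; omega)
      (by simp [Function.update, (k 9 (by simp)).2.2, e₉])
      (by simp [Function.update, (k 12 (by simp)).2.2, e₁₂])
    simp only [Function.update, reduceDIte, Nat.reduceEqDiff,
      (k 8 (by simp)).2.2, (k 10 (by simp)).2.2, e₈, e₁₀, hq] at hn₅ hL
    refine ⟨R₅, L, _, ?_, .seq x₁ (.seq x₂ (.seq x₃ (.seq x₄ (.seq x₅ (.ite_zero ?_ x₆))))), ?_⟩
    · unfold searchBound
      omega
    · simp; omega
    · intro a v
      rw [hL]
      simp only [hp, true_and]
      rfl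
  -- A superfluous processor succeeds in all three subtractions; area 3 does not exist, so it stays
  -- idle.
  · have hq : R₄ 3 = 3 := by
      split_ifs at * <;> omega
    refine ⟨_, _, _, ?_, .seq x₁ (.seq x₂ (.seq x₃ (.seq x₄ (.seq x₅ (.ite_ne ?_ (.skip _)))))),
      ?_⟩
    · omega
    · simp [hq]
    · simp [hp]

/-! ### Assembly of the blocks into the output of the whole machine. -/

theorem getElem?_flatMap_range {α : Type*} {F : ℕ → List α} {m : ℕ} (hF : ∀ p, (F p).length = m)
    {j : ℕ} (hj : j < m) : ∀ {n p : ℕ}, p < n →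
      ((List.range n).flatMap F)[m * p + j]? = (F p)[j]?
  | n + 1, p, hp => by
    have hl : ((List.range n).flatMap F).length = m * n := by
      simp [List.length_flatMap, hF, Nat.mul_comm]
    rw [List.range_succ, List.flatMap_append]
    rcases (Nat.lt_succ_iff_lt_or_eq.1 hp) with hp | rfl
    · have : m * (p + 1) ≤ m * n := Nat.mul_le_mul_left m hp
      rw [List.getElem?_append_left (by rw [hl]; rw [Nat.mul_add] at this; omega),
        getElem?_flatMap_range hF hj hp]
    · rw [List.getElem?_append_right (by omega), hl, Nat.add_sub_cancel_left]
      simp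

theorem getElem?_reduction {D : List Letter} {p j : ℕ} (hp : p < 3 * (D.length + 1))
    (hj : j < 9) : (reduction D)[9 * p + j]? = some ((numberedBlock D p).getD j .blank) := by
  have hl : ∀ p, (padBlock (numberedBlock D p)).length = 9 :=
    fun p => length_padBlock (length_areaBlock_le _ _ _ _)
  have e : (reduction D)[9 * p + j]? = (padBlock (numberedBlock D p))[j]? :=
    getElem?_flatMap_range hl hj hp
  rw [e, padBlock]
  rcases lt_or_ge j (numberedBlock D p).length with h | h
  · rw [List.getElem?_append_left h, List.getD_eq_getElem?_getD, List.getElem?_eq_getElem h]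
    rfl
  · rw [List.getElem?_append_right h, List.getD_eq_getElem?_getD, List.getElem?_eq_none h,
      List.getElem?_replicate, if_pos (by omega)]
    rfl

theorem outputsWithin_reduction (D : List Letter) {procs T : ℕ}
    (hprocs : 3 * (D.length + 1) ≤ procs) (hT : 14 * searchBound D.length + 170 ≤ T) :
    OutputsWithin (reductionCmd.compile 0) procs D (reduction D) T := by
  have halt : ∀ σ, (reductionCmd.compile 0)[(Cmd.atPc reductionCmd.size σ).pc]? = none := by
    intro σ
    rw [List.getElem?_eq_none]
    rw [Cmd.length_compile]
    rfl
  refine outputsWithin_of_localRun (allPlain_reductionCmd.not_isLoad 0) ?_ ?_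
  · intro p _
    obtain ⟨R, L, n, hn, h, hL⟩ := exec_reductionCmd D p
    refine ⟨n, by omega, ?_, ?_⟩
    · rw [h.localRun]; exact halt _
    · rw [h.localRun]
      intro a v hav
      obtain ⟨hp, j, hj, rfl, rfl⟩ := (hL a v).1 hav
      rw [getElem?_reduction hp hj]
      rfl
  · intro a ha
    rw [length_reduction] at ha
    have hp : a / 9 < 3 * (D.length + 1) := by omega
    refine ⟨a / 9, by omega, fun s _ hs => ?_⟩
    obtain ⟨R, L, n, hn, h, hL⟩ := exec_reductionCmd D (a / 9)
    have h' := h.localRun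
    -- A halted processor does not change any more, so all its halted states coincide.
    have e : localRun (reductionCmd.compile 0) D (a / 9) s =
        localRun (reductionCmd.compile 0) D (a / 9) n := by
      have hn' : (reductionCmd.compile 0)[(localRun (reductionCmd.compile 0) D (a / 9) n).pc]? =
          none := by rw [h']; exact halt _
      rw [← localRun_halted hs n, Nat.add_comm, localRun_halted hn']
    rw [e, h']
    exact ⟨_, (hL a _).2 ⟨hp, a % 9, Nat.mod_lt _ (by omega), (Nat.div_add_mod a 9).symm, rfl⟩⟩

end PRAM

theorem linearSizeNC_reduction : LinearSizeNC reduction := by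
  -- One constant serves as factor, exponent and summand. It has to exceed `14 * 2 + 170`, since the
  -- search bound is at most `Nat.log 2 D.length + 2`; the size of the exponent is immaterial.
  refine ⟨⟨PRAM.reductionCmd.compile 0, 250, fun D => ?_⟩, 27, fun D => ?_⟩
  · refine PRAM.outputsWithin_reduction D ?_ ?_
    · have : D.length ^ 2 ≤ D.length ^ 250 + 1 := by
        rcases Nat.eq_zero_or_pos D.length with h | h
        · simp [h]
        · exact (Nat.pow_le_pow_right h (by norm_num)).trans (Nat.le_succ _)
      nlinarith
    · have h₁ : searchBound D.length ≤ Nat.log 2 D.length + 2 := by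
        unfold searchBound
        rw [Nat.size_le]
        have := Nat.lt_pow_succ_log_self (b := 2) (by norm_num) D.length
        rw [pow_succ] at this ⊢
        omega
      have h₂ : Nat.log 2 D.length ≤ Nat.log 2 D.length ^ 250 := Nat.le_self_pow (by norm_num) _
      omega
  · rw [length_reduction]
    omega

/-- The circuit value problem is reducible to the algebraic equation root problem. -/
theorem theorem4 : PsTReducible CVP AERP := by
  refine ⟨reduction, reduction, fun x y => translateInputs (rounds 0 x.length) y,
    linearSizeNC_reduction, linearSizeNC_reduction, psTComputable_translateInputs,
    fun D P => cvp_iff_aerp _ D P fun C hD => ?_⟩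
  -- The bound is taken for the length of `reduction D`, the string that `g` receives; it is longer
  -- than `D`, of which the input records are a prefix.
  apply lt_rounds _ 0
  rw [length_reduction, hD, C.encode_eq, List.length_append]
  omega
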